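/- Let $X$ be a compact metric space and let $T\colon X\to X$ be a continuous map that is uniquely ergodic, i.e. there is exactly one Borel probability measure $\mu$ on $X$ that is $T$-invariant ($\mu(T^{-1}A)=\mu(A)$ for all Borel sets $A\subset X$). For a positive integer $n$, let $\Omega(n)$ denote the number of prime factors of $n$ counted with multiplicity. Then for every point $x\in X$ and every continuous function $f\colon X\to\mathbb{C}$, $$\lim_{N\to\infty}\frac{1}{N}\sum_{\substack{1\le n\le N\\ n\text{ squarefree}}} f\big(T^{\Omega(n)}x\big)=\frac{6}{\pi^2}\int_X f\,d\mu .$$ -/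

import Mathlib

open MeasureTheory

/-- `μ` is the unique `T`-invariant Borel probability measure on `X`: it is a `T`-invariant
probability measure, and every `T`-invariant probability measure equals `μ`. -/
structure IsUniquelyErgodic {X : Type*} [MeasurableSpace X] (T : X → X) (μ : Measure X) :
    Prop where
  isProbabilityMeasure : IsProbabilityMeasure μ
  invariant : MeasurePreserving T μ μ
  unique : ∀ ν : Measure X, IsProbabilityMeasure ν → MeasurePreserving T ν ν → ν = μ

/-! For real continuous `g` put a(k) = g(T^k x). The heart is that the mean of a(Ω(n)) over
squarefree n does not change in the limit when a is shifted by one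
(`tendsto_meanUpTo_squarefree_shift`). Granting this, a(Ω(n)) may be replaced by its average over
many consecutive shifts. Unique ergodicity makes that average close to ∫ g dμ uniformly in the
starting point (`exists_uniform_average`), so only the density 6/π² of the squarefree numbers
remains (`tendsto_meanUpTo_squarefree`).

Shift invariance avoids the prime number theorem. Let b_j(n) = a(Ω(n) + j) on squarefree n and 0
elsewhere, so b_j(pm) = b_{j+1}(m) for every prime p not dividing m. Let G_j(s) be the limit, along
an ultrafilter, of the mean of b_j up to N e^s. A Turán–Kubilius argument bounds ∑ p⁻¹ (G_j(s) -
G_{j+1}(s - log p))² over primes (`limit_sum_sq_le`), so G_j(s) is nearly G_{j+1}(s - log p) for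
most p. Two such primes p, q make log q - log p an almost period of G_j. Chebyshev's bounds supply
many primes and Selberg's sieve prevents them from clustering, so this gap can be found in [ε, η]
with ε depending on η alone (`exists_good_prime_pair`). The error can then be sent to 0 with the gap
bounded below, and the Lipschitz function G_j must be constant (`eq_of_prime_shift`). Divergence of
∑ 1/p finally gives G_0(0) = G_1(0). -/

/-! ### Elementary estimates for Möbius and von Mangoldt sums. -/

theorem sum_Icc_sum_Icc_div (N : ℕ) (g : ℕ → ℕ → ℝ) :
    ∑ d ∈ Finset.Icc 1 N, ∑ n ∈ Finset.Icc 1 (N / d), g d n =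
      ∑ k ∈ Finset.Icc 1 N, ∑ z ∈ k.divisorsAntidiagonal, g z.1 z.2 := by
  rw [Finset.sum_sigma', Finset.sum_sigma']
  refine Finset.sum_bij' (fun z _ => ⟨z.1 * z.2, (z.1, z.2)⟩) (fun z _ => ⟨z.2.1, z.2.2⟩)
    ?_ ?_ ?_ ?_ ?_
  · rintro ⟨d, n⟩ h
    simp only [Finset.mem_sigma, Finset.mem_Icc] at h
    obtain ⟨⟨h1, h2⟩, h3, h4⟩ := h
    have h5 : d * n ≤ N := by
      rw [Nat.le_div_iff_mul_le h1] at h4; linarith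
    simp only [Finset.mem_sigma, Finset.mem_Icc, Nat.mem_divisorsAntidiagonal]
    exact ⟨⟨Nat.mul_pos h1 h3, h5⟩, trivial, (Nat.mul_pos h1 h3).ne'⟩
  · rintro ⟨k, d, n⟩ h
    simp only [Finset.mem_sigma, Finset.mem_Icc, Nat.mem_divisorsAntidiagonal] at h
    obtain ⟨⟨h1, h2⟩, rfl, h4⟩ := h
    have hd : 0 < d := Nat.pos_of_ne_zero (by rintro rfl; simp at h4)
    have hn : 0 < n := Nat.pos_of_ne_zero (by rintro rfl; simp at h4)
    simp only [Finset.mem_sigma, Finset.mem_Icc]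
    refine ⟨⟨hd, le_trans (Nat.le_mul_of_pos_right d hn) h2⟩, hn, ?_⟩
    rw [Nat.le_div_iff_mul_le hd]; linarith
  · rintro ⟨d, n⟩ h; rfl
  · rintro ⟨k, d, n⟩ h
    simp only [Finset.mem_sigma, Nat.mem_divisorsAntidiagonal] at h
    obtain ⟨h1, rfl, h4⟩ := h
    rfl
  · rintro ⟨d, n⟩ h; rfl

theorem natCast_floor_div_bounds {x : ℝ} (hx : 0 ≤ x) {d : ℕ} :
    ((⌊x⌋₊ / d : ℕ) : ℝ) ≤ x / d ∧ x / d < ((⌊x⌋₊ / d : ℕ) : ℝ) + 1 := by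
  rw [← Nat.floor_div_natCast]
  exact ⟨Nat.floor_le (by positivity), Nat.lt_floor_add_one _⟩

theorem sum_divisorsAntidiagonal_moebius {k : ℕ} :
    ∑ z ∈ k.divisorsAntidiagonal, ((ArithmeticFunction.moebius z.1 : ℤ) : ℝ) =
      if k = 1 then 1 else 0 := by
  have h := congrArg (fun f : ArithmeticFunction ℤ => f k)
    ArithmeticFunction.moebius_mul_coe_zeta
  simp only [ArithmeticFunction.mul_apply, ArithmeticFunction.one_apply] at h
  have h2 : ∑ z ∈ k.divisorsAntidiagonal, ArithmeticFunction.moebius z.1 =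
      if k = 1 then 1 else 0 := by
    rw [← h]
    refine Finset.sum_congr rfl fun z hz => ?_
    have : z.2 ≠ 0 := by
      rintro h0
      rw [Nat.mem_divisorsAntidiagonal] at hz
      simp [h0] at hz; omega
    simp [ArithmeticFunction.natCoe_apply, ArithmeticFunction.zeta_apply, this]
  exact_mod_cast h2

theorem abs_moebius_cast_le_one (d : ℕ) : |((ArithmeticFunction.moebius d : ℤ) : ℝ)| ≤ 1 := by
  exact_mod_cast ArithmeticFunction.abs_moebius_le_one (n := d)

/-- ∑ μ(d)⌊x/d⌋ = 1, and dropping the floors costs at most 1 per term, hence at most x in all;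
divide by x. -/
theorem abs_sum_moebius_div_le {x : ℝ} (hx : 1 ≤ x) :
    |∑ d ∈ Finset.Icc 1 ⌊x⌋₊, ((ArithmeticFunction.moebius d : ℤ) : ℝ) / d| ≤ 2 := by
  set N := ⌊x⌋₊ with hN
  have hN1 : 1 ≤ N := by rw [hN, Nat.one_le_floor_iff]; exact hx
  have h1 : ∑ d ∈ Finset.Icc 1 N, ((ArithmeticFunction.moebius d : ℤ) : ℝ) * ((N / d : ℕ) : ℝ)
      = 1 := by
    have := sum_Icc_sum_Icc_div N (fun d _ => ((ArithmeticFunction.moebius d : ℤ) : ℝ))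
    simp only [Finset.sum_const, Nat.card_Icc, add_tsub_cancel_right, nsmul_eq_mul] at this
    rw [Finset.sum_congr rfl (fun d _ => mul_comm _ _), this, Finset.sum_congr rfl
      (fun k _ => sum_divisorsAntidiagonal_moebius)]
    simp [hN1]
  have h2 : |∑ d ∈ Finset.Icc 1 N, ((ArithmeticFunction.moebius d : ℤ) : ℝ) *
      (x / d - ((N / d : ℕ) : ℝ))| ≤ N := by
    refine (Finset.abs_sum_le_sum_abs _ _).trans ?_
    calc _ ≤ ∑ d ∈ Finset.Icc 1 N, (1 : ℝ) := by
          refine Finset.sum_le_sum fun d _ => ?_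
          rw [abs_mul]
          have := natCast_floor_div_bounds (x := x) (by linarith) (d := d)
          refine mul_le_one₀ (abs_moebius_cast_le_one d) (abs_nonneg _) ?_
          rw [abs_le]; constructor <;> linarith [this.1, this.2]
      _ = N := by simp
  have h3 : x * ∑ d ∈ Finset.Icc 1 N, ((ArithmeticFunction.moebius d : ℤ) : ℝ) / d =
      1 + ∑ d ∈ Finset.Icc 1 N, ((ArithmeticFunction.moebius d : ℤ) : ℝ) *
      (x / d - ((N / d : ℕ) : ℝ)) := by
    rw [← h1, ← Finset.sum_add_distrib, Finset.mul_sum]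
    refine Finset.sum_congr rfl fun d _ => ?_
    ring
  have hNx : (N : ℝ) ≤ x := Nat.floor_le (by linarith)
  have h4 : |x * ∑ d ∈ Finset.Icc 1 N, ((ArithmeticFunction.moebius d : ℤ) : ℝ) / d| ≤ 2 * x := by
    rw [h3]
    refine (abs_add_le _ _).trans ?_
    rw [abs_one]; linarith
  rw [abs_mul, abs_of_pos (by linarith : 0 < x)] at h4
  nlinarith

/-- The harmonic sum up to `y` is `log y + γ + O(1/y)`. -/
theorem abs_sum_inv_sub_log_sub_gamma_le {y : ℝ} (hy : 1 ≤ y) :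
    |∑ n ∈ Finset.Icc 1 ⌊y⌋₊, (n : ℝ)⁻¹ - Real.log y - Real.eulerMascheroniConstant| ≤ 2 / y := by
  set n := ⌊y⌋₊ with hn
  have hn1 : 1 ≤ n := by rw [hn, Nat.one_le_floor_iff]; exact hy
  have hn0 : (1 : ℝ) ≤ n := by exact_mod_cast hn1
  have hny : (n : ℝ) ≤ y := Nat.floor_le (by linarith)
  have hny2 : y < n + 1 := Nat.lt_floor_add_one y
  have hH : ∑ k ∈ Finset.Icc 1 n, (k : ℝ)⁻¹ = (harmonic n : ℝ) := by
    rw [harmonic_eq_sum_Icc]; push_cast; rfl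
  have h1 := Real.eulerMascheroniSeq_lt_eulerMascheroniConstant n
  have h2 := Real.eulerMascheroniConstant_lt_eulerMascheroniSeq' n
  rw [Real.eulerMascheroniSeq] at h1
  rw [Real.eulerMascheroniSeq', if_neg (by omega)] at h2
  have h3 : Real.log n ≤ Real.log y := Real.log_le_log (by linarith) hny
  have h4 : Real.log y ≤ Real.log (n + 1) := Real.log_le_log (by linarith) hny2.le
  have h5 : Real.log (n + 1) - Real.log n ≤ 1 / n := by
    rw [← Real.log_div (by positivity) (by positivity)]
    refine (Real.log_le_sub_one_of_pos (by positivity)).trans (le_of_eq ?_)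
    field_simp; ring
  have h6 : 1 / (n : ℝ) ≤ 2 / y := by
    rw [div_le_div_iff₀ (by linarith) (by linarith)]; linarith
  rw [hH, abs_le]
  constructor <;> linarith

theorem sum_inv_sqrt_le (N : ℕ) : ∑ d ∈ Finset.Icc 1 N, 1 / √(d : ℝ) ≤ 2 * √(N : ℝ) := by
  induction N with
  | zero => simp
  | succ n ih =>
    rw [Finset.sum_Icc_succ_top (by omega)]
    have h1 : 0 < √((n + 1 : ℕ) : ℝ) := Real.sqrt_pos.mpr (by positivity)
    have h2 : √((n + 1 : ℕ) : ℝ) ^ 2 = n + 1 := by rw [Real.sq_sqrt (by positivity)]; push_cast; ring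
    have h3 : √(n : ℝ) ^ 2 = n := Real.sq_sqrt (by positivity)
    have h4 := Real.sqrt_nonneg (n : ℝ)
    suffices 1 / √((n + 1 : ℕ) : ℝ) ≤ 2 * √((n + 1 : ℕ) : ℝ) - 2 * √(n : ℝ) by linarith
    rw [div_le_iff₀ h1]
    nlinarith [sq_nonneg (√((n + 1 : ℕ) : ℝ) - √(n : ℝ))]

theorem sum_sqrt_div_le {x : ℝ} (hx : 1 ≤ x) :
    ∑ d ∈ Finset.Icc 1 ⌊x⌋₊, √(x / d) ≤ 2 * x := by
  calc _ = √x * ∑ d ∈ Finset.Icc 1 ⌊x⌋₊, 1 / √(d : ℝ) := by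
        rw [Finset.mul_sum]
        refine Finset.sum_congr rfl fun d _ => ?_
        rw [Real.sqrt_div (by linarith)]; ring
    _ ≤ √x * (2 * √x) := by
        gcongr
        refine (sum_inv_sqrt_le _).trans ?_
        gcongr
        exact Nat.floor_le (by linarith)
    _ = 2 * x := by
        rw [mul_left_comm, Real.mul_self_sqrt (by linarith)]

theorem sq_log_le_mul_sqrt {z : ℝ} (hz : 1 ≤ z) : Real.log z ^ 2 ≤ 16 * √z := by
  have h := Real.log_le_rpow_div (x := z) (ε := 1 / 4) (by linarith) (by norm_num)
  have h0 := Real.log_nonneg hz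
  calc Real.log z ^ 2 ≤ (z ^ (1 / 4 : ℝ) / (1 / 4)) ^ 2 := by gcongr
    _ = 16 * √z := by
      rw [div_pow, ← Real.rpow_natCast, ← Real.rpow_mul (by linarith), Real.sqrt_eq_rpow]
      norm_num; ring

theorem one_le_div_of_mem_Icc_floor {x : ℝ} (hx : 1 ≤ x) {d : ℕ}
    (hd : d ∈ Finset.Icc 1 ⌊x⌋₊) : 1 ≤ (d : ℝ) ∧ 1 ≤ x / d := by
  rw [Finset.mem_Icc] at hd
  have h1 : (1 : ℝ) ≤ d := by exact_mod_cast hd.1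
  have h2 : (d : ℝ) ≤ x := (Nat.le_floor_iff (by linarith)).mp hd.2
  exact ⟨h1, by rw [le_div_iff₀ (by linarith)]; linarith⟩

theorem sum_sq_log_div_le {x : ℝ} (hx : 1 ≤ x) :
    ∑ d ∈ Finset.Icc 1 ⌊x⌋₊, Real.log (x / d) ^ 2 ≤ 32 * x := by
  calc _ ≤ ∑ d ∈ Finset.Icc 1 ⌊x⌋₊, 16 * √(x / d) :=
        Finset.sum_le_sum fun d hd => sq_log_le_mul_sqrt (one_le_div_of_mem_Icc_floor hx hd).2
    _ ≤ 32 * x := by rw [← Finset.mul_sum]; linarith [sum_sqrt_div_le hx]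

theorem sum_log_div_le {x : ℝ} (hx : 1 ≤ x) :
    ∑ d ∈ Finset.Icc 1 ⌊x⌋₊, Real.log (x / d) ≤ 33 * x := by
  have hNx : (⌊x⌋₊ : ℝ) ≤ x := Nat.floor_le (by linarith)
  calc _ ≤ ∑ d ∈ Finset.Icc 1 ⌊x⌋₊, (1 + Real.log (x / d) ^ 2) :=
        Finset.sum_le_sum fun d hd => by nlinarith [sq_nonneg (Real.log (x / d) - 1)]
    _ ≤ 33 * x := by
        rw [Finset.sum_add_distrib]
        simp only [Finset.sum_const, Nat.card_Icc, add_tsub_cancel_right, nsmul_eq_mul, mul_one]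
        linarith [sum_sq_log_div_le hx]

theorem sum_moebius_div_mul_sum_inv {x : ℝ} (hx : 1 ≤ x) :
    ∑ d ∈ Finset.Icc 1 ⌊x⌋₊, ((ArithmeticFunction.moebius d : ℤ) : ℝ) / d *
      ∑ n ∈ Finset.Icc 1 (⌊x⌋₊ / d), (n : ℝ)⁻¹ = 1 := by
  set N := ⌊x⌋₊ with hN
  have hN1 : 1 ≤ N := by rw [hN, Nat.one_le_floor_iff]; exact hx
  simp only [Finset.mul_sum]
  rw [sum_Icc_sum_Icc_div N
    (fun d n => ((ArithmeticFunction.moebius d : ℤ) : ℝ) / d * (n : ℝ)⁻¹)]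
  calc _ = ∑ k ∈ Finset.Icc 1 N, (k : ℝ)⁻¹ * (if k = 1 then 1 else 0) := by
        refine Finset.sum_congr rfl fun k _ => ?_
        rw [← sum_divisorsAntidiagonal_moebius, Finset.mul_sum]
        refine Finset.sum_congr rfl fun z hz => ?_
        rw [Nat.mem_divisorsAntidiagonal] at hz
        rw [← hz.1]; push_cast
        rw [mul_inv]; ring
    _ = 1 := by simp [hN1]

theorem sum_moebius_mul_log {k : ℕ} :
    ∑ z ∈ k.divisorsAntidiagonal, ((ArithmeticFunction.moebius z.1 : ℤ) : ℝ) * Real.log z.2 =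
      ArithmeticFunction.vonMangoldt k := by
  rw [← ArithmeticFunction.moebius_mul_log_eq_vonMangoldt, ArithmeticFunction.mul_apply]
  simp [ArithmeticFunction.log_apply, ArithmeticFunction.intCoe_apply]

/-- Grouping by k = dn splits log(x/d) as log(x/k) + log n: the first part is killed by ∑ μ except
at k = 1, the second is μ * log = Λ. -/
theorem sum_moebius_div_mul_log_mul_sum_inv {x : ℝ} (hx : 1 ≤ x) :
    ∑ d ∈ Finset.Icc 1 ⌊x⌋₊, ((ArithmeticFunction.moebius d : ℤ) : ℝ) / d * Real.log (x / d) *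
      ∑ n ∈ Finset.Icc 1 (⌊x⌋₊ / d), (n : ℝ)⁻¹ =
    Real.log x + ∑ k ∈ Finset.Icc 1 ⌊x⌋₊, ArithmeticFunction.vonMangoldt k / k := by
  set N := ⌊x⌋₊ with hN
  have hN1 : 1 ≤ N := by rw [hN, Nat.one_le_floor_iff]; exact hx
  simp only [Finset.mul_sum]
  rw [sum_Icc_sum_Icc_div N
    (fun d n => ((ArithmeticFunction.moebius d : ℤ) : ℝ) / d * Real.log (x / d) * (n : ℝ)⁻¹)]
  calc _ = ∑ k ∈ Finset.Icc 1 N, ((k : ℝ)⁻¹ * Real.log (x / k) * (if k = 1 then 1 else 0) +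
          ArithmeticFunction.vonMangoldt k / k) := by
        refine Finset.sum_congr rfl fun k _ => ?_
        rw [← sum_divisorsAntidiagonal_moebius, ← sum_moebius_mul_log, Finset.mul_sum,
          Finset.sum_div, ← Finset.sum_add_distrib]
        refine Finset.sum_congr rfl fun z hz => ?_
        rw [Nat.mem_divisorsAntidiagonal] at hz
        have h1 : (z.1 : ℝ) ≠ 0 := by
          intro h; have : z.1 = 0 := by exact_mod_cast h
          rw [this] at hz; omega
        have h2 : (z.2 : ℝ) ≠ 0 := by
          intro h; have : z.2 = 0 := by exact_mod_cast h
          rw [this] at hz; omega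
        rw [← hz.1]; push_cast
        rw [Real.log_div (by linarith) h1, Real.log_div (by linarith) (mul_ne_zero h1 h2),
          Real.log_mul h1 h2]
        field_simp; ring
    _ = _ := by rw [Finset.sum_add_distrib]; simp [hN1]

/-- The upper half of Mertens' theorem: ∑ Λ(k)⌊N/k⌋ = log N! ≤ x log x, and Chebyshev's bound for ψ
pays for removing the floors. -/
theorem sum_vonMangoldt_div_le : ∃ C : ℝ, ∀ x : ℝ, 1 ≤ x →
    ∑ k ∈ Finset.Icc 1 ⌊x⌋₊, ArithmeticFunction.vonMangoldt k / k ≤ Real.log x + C := by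
  refine ⟨Real.log 4 + 4, fun x hx => ?_⟩
  set N := ⌊x⌋₊ with hN
  have hNx : (N : ℝ) ≤ x := Nat.floor_le (by linarith)
  have h1 : ∑ k ∈ Finset.Icc 1 N, ArithmeticFunction.vonMangoldt k * ((N / k : ℕ) : ℝ) =
      ∑ k ∈ Finset.Icc 1 N, Real.log k := by
    have := sum_Icc_sum_Icc_div N (fun d _ => ArithmeticFunction.vonMangoldt d)
    simp only [Finset.sum_const, Nat.card_Icc, add_tsub_cancel_right, nsmul_eq_mul] at this
    rw [Finset.sum_congr rfl (fun d _ => mul_comm _ _), this]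
    refine Finset.sum_congr rfl fun k _ => ?_
    rw [Nat.sum_divisorsAntidiagonal (fun a _ => ArithmeticFunction.vonMangoldt a),
      ArithmeticFunction.vonMangoldt_sum]
  have h2 : ∑ k ∈ Finset.Icc 1 N, Real.log k ≤ x * Real.log x := by
    calc _ ≤ ∑ k ∈ Finset.Icc 1 N, Real.log x := by
          refine Finset.sum_le_sum fun k hk => ?_
          obtain ⟨h3, h4⟩ := one_le_div_of_mem_Icc_floor hx hk
          rw [le_div_iff₀ (by linarith)] at h4
          exact Real.log_le_log (by linarith) (by linarith)
      _ = N * Real.log x := by simp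
      _ ≤ _ := by gcongr; exact Real.log_nonneg hx
  have h3 : ∑ k ∈ Finset.Icc 1 N, ArithmeticFunction.vonMangoldt k = Chebyshev.psi x := by
    rw [Chebyshev.psi_eq_sum_Icc]
    rw [← Finset.insert_Icc_add_one_left_eq_Icc (Nat.zero_le _), Finset.sum_insert (by simp)]
    simp [hN]
  have h4 := Chebyshev.psi_le_const_mul_self (x := x) (by linarith)
  have h5 : x * ∑ k ∈ Finset.Icc 1 N, ArithmeticFunction.vonMangoldt k / k ≤
      x * (Real.log x + (Real.log 4 + 4)) := by
    calc _ = ∑ k ∈ Finset.Icc 1 N, ArithmeticFunction.vonMangoldt k * (x / k) := by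
          rw [Finset.mul_sum]; exact Finset.sum_congr rfl fun k _ => by ring
      _ ≤ ∑ k ∈ Finset.Icc 1 N, (ArithmeticFunction.vonMangoldt k * ((N / k : ℕ) : ℝ) +
            ArithmeticFunction.vonMangoldt k) := by
          refine Finset.sum_le_sum fun k _ => ?_
          have h6 := (natCast_floor_div_bounds (x := x) (by linarith) (d := k)).2
          have h7 : 0 ≤ ArithmeticFunction.vonMangoldt k := ArithmeticFunction.vonMangoldt_nonneg
          nlinarith
      _ ≤ _ := by rw [Finset.sum_add_distrib, h1, h3]; linarith
  exact le_of_mul_le_mul_left h5 (by linarith)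

/-- In the identity ∑ (μ(d)/d) H(x/d) = 1 replace the harmonic sum H(y) by log y + γ + O(1/y); the
errors add up to O(1). -/
theorem abs_sum_moebius_div_mul_log_le {x : ℝ} (hx : 1 ≤ x) :
    |∑ d ∈ Finset.Icc 1 ⌊x⌋₊, ((ArithmeticFunction.moebius d : ℤ) : ℝ) / d * Real.log (x / d)|
      ≤ 5 := by
  set N := ⌊x⌋₊ with hN
  set γ := Real.eulerMascheroniConstant with hγ
  have hNx : (N : ℝ) ≤ x := Nat.floor_le (by linarith)
  have hγ1 := Real.one_half_lt_eulerMascheroniConstant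
  have hγ2 := Real.eulerMascheroniConstant_lt_two_thirds
  set H : ℕ → ℝ := fun m => ∑ n ∈ Finset.Icc 1 m, (n : ℝ)⁻¹ with hH
  have h1 : ∑ d ∈ Finset.Icc 1 N, ((ArithmeticFunction.moebius d : ℤ) : ℝ) / d * H (N / d) = 1 :=
    sum_moebius_div_mul_sum_inv hx
  have h2 := abs_sum_moebius_div_le hx
  have h3 : |∑ d ∈ Finset.Icc 1 N, ((ArithmeticFunction.moebius d : ℤ) : ℝ) / d *
      (H (N / d) - Real.log (x / d) - γ)| ≤ 2 := by
    refine (Finset.abs_sum_le_sum_abs _ _).trans ?_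
    calc _ ≤ ∑ d ∈ Finset.Icc 1 N, 2 / x := by
          refine Finset.sum_le_sum fun d hd => ?_
          obtain ⟨hd1, hd2⟩ := one_le_div_of_mem_Icc_floor hx hd
          have h4 := abs_sum_inv_sub_log_sub_gamma_le hd2
          rw [Nat.floor_div_natCast] at h4
          have h5 := abs_moebius_cast_le_one d
          rw [abs_mul, abs_div, abs_of_pos (by linarith : (0 : ℝ) < d)]
          calc _ ≤ 1 / (d : ℝ) * (2 / (x / d)) := by gcongr
            _ = 2 / x := by field_simp
      _ = N * (2 / x) := by simp
      _ ≤ 2 := by rw [mul_div_assoc', div_le_iff₀ (by linarith)]; linarith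
  have h4 : ∑ d ∈ Finset.Icc 1 N, ((ArithmeticFunction.moebius d : ℤ) : ℝ) / d * Real.log (x / d) =
      1 - γ * ∑ d ∈ Finset.Icc 1 N, ((ArithmeticFunction.moebius d : ℤ) : ℝ) / d -
      ∑ d ∈ Finset.Icc 1 N, ((ArithmeticFunction.moebius d : ℤ) : ℝ) / d *
      (H (N / d) - Real.log (x / d) - γ) := by
    rw [← h1, Finset.mul_sum, ← Finset.sum_sub_distrib, ← Finset.sum_sub_distrib]
    exact Finset.sum_congr rfl fun d _ => by ring
  rw [h4]
  rw [abs_le] at h2 h3 ⊢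
  constructor <;> nlinarith

/-- The same replacement with an extra factor log(x/d). The main term is now log x + ∑ Λ(k)/k, where
only the upper Mertens bound is needed. -/
theorem sum_moebius_div_mul_sq_log_le : ∃ C : ℝ, 0 ≤ C ∧ ∀ x : ℝ, 1 ≤ x →
    ∑ d ∈ Finset.Icc 1 ⌊x⌋₊, ((ArithmeticFunction.moebius d : ℤ) : ℝ) / d * Real.log (x / d) ^ 2
      ≤ 2 * Real.log x + C := by
  obtain ⟨C, hC⟩ := sum_vonMangoldt_div_le
  refine ⟨|C| + 5 + 66, by positivity, fun x hx => ?_⟩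
  set N := ⌊x⌋₊ with hN
  set γ := Real.eulerMascheroniConstant with hγ
  have hγ1 := Real.one_half_lt_eulerMascheroniConstant
  have hγ2 := Real.eulerMascheroniConstant_lt_two_thirds
  set H : ℕ → ℝ := fun m => ∑ n ∈ Finset.Icc 1 m, (n : ℝ)⁻¹ with hH
  have h1 : ∑ d ∈ Finset.Icc 1 N, ((ArithmeticFunction.moebius d : ℤ) : ℝ) / d * Real.log (x / d) *
      H (N / d) = _ := sum_moebius_div_mul_log_mul_sum_inv hx
  have h2 := abs_sum_moebius_div_mul_log_le hx
  have h3 : |∑ d ∈ Finset.Icc 1 N, ((ArithmeticFunction.moebius d : ℤ) : ℝ) / d *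
      Real.log (x / d) * (H (N / d) - Real.log (x / d) - γ)| ≤ 66 := by
    refine (Finset.abs_sum_le_sum_abs _ _).trans ?_
    calc _ ≤ ∑ d ∈ Finset.Icc 1 N, 2 / x * Real.log (x / d) := by
          refine Finset.sum_le_sum fun d hd => ?_
          obtain ⟨hd1, hd2⟩ := one_le_div_of_mem_Icc_floor hx hd
          have h4 := abs_sum_inv_sub_log_sub_gamma_le hd2
          rw [Nat.floor_div_natCast] at h4
          have h5 := abs_moebius_cast_le_one d
          have h6 := Real.log_nonneg hd2
          rw [abs_mul, abs_mul, abs_div, abs_of_pos (by linarith : (0 : ℝ) < d), abs_of_nonneg h6]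
          calc _ ≤ 1 / (d : ℝ) * Real.log (x / d) * (2 / (x / d)) := by gcongr
            _ = 2 / x * Real.log (x / d) := by field_simp
      _ = 2 / x * ∑ d ∈ Finset.Icc 1 N, Real.log (x / d) := by rw [Finset.mul_sum]
      _ ≤ 2 / x * (33 * x) := by gcongr; exact sum_log_div_le hx
      _ = 66 := by field_simp; norm_num
  have h4 : ∑ d ∈ Finset.Icc 1 N, ((ArithmeticFunction.moebius d : ℤ) : ℝ) / d *
      Real.log (x / d) ^ 2 =
      Real.log x + ∑ k ∈ Finset.Icc 1 N, ArithmeticFunction.vonMangoldt k / k -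
      γ * ∑ d ∈ Finset.Icc 1 N, ((ArithmeticFunction.moebius d : ℤ) : ℝ) / d * Real.log (x / d) -
      ∑ d ∈ Finset.Icc 1 N, ((ArithmeticFunction.moebius d : ℤ) : ℝ) / d *
      Real.log (x / d) * (H (N / d) - Real.log (x / d) - γ) := by
    rw [← h1, Finset.mul_sum, ← Finset.sum_sub_distrib, ← Finset.sum_sub_distrib]
    exact Finset.sum_congr rfl fun d _ => by ring
  rw [h4]
  have h5 := hC x hx
  have h6 := le_abs_self C
  rw [abs_le] at h2 h3
  nlinarith

/-! ### Selberg's upper bound for primes in short intervals. -/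

/-- Selberg's weights dominate `Λ(n) log n`. -/
theorem vonMangoldt_mul_log_le_sum {x : ℝ} {n : ℕ} (hn : 1 ≤ n) (hnx : (n : ℝ) ≤ x) :
    ArithmeticFunction.vonMangoldt n * Real.log n ≤ ∑ d ∈ n.divisors,
      ((ArithmeticFunction.moebius d : ℤ) : ℝ) * Real.log (x / d) ^ 2 := by
  have hn1 : (1 : ℝ) ≤ n := by exact_mod_cast hn
  have hx : 0 < x := by linarith
  let f : ArithmeticFunction ℝ :=
    ((ArithmeticFunction.moebius : ArithmeticFunction ℤ) : ArithmeticFunction ℝ).pmul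
      ArithmeticFunction.log
  have hf : ∀ d, f d = ((ArithmeticFunction.moebius d : ℤ) : ℝ) * Real.log d := fun d => by
    simp [f, ArithmeticFunction.log_apply, ArithmeticFunction.intCoe_apply]
  have hML : ∀ m : ℕ, ∑ d ∈ m.divisors, ((ArithmeticFunction.moebius d : ℤ) : ℝ) * Real.log d =
      -ArithmeticFunction.vonMangoldt m := fun m => by
    simpa [ArithmeticFunction.log_apply] using
      ArithmeticFunction.sum_moebius_mul_log_eq (n := m)
  have hfz : f * (ArithmeticFunction.zeta : ArithmeticFunction ℝ) =
      -ArithmeticFunction.vonMangoldt := by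
    ext m
    rw [ArithmeticFunction.coe_mul_zeta_apply, ArithmeticFunction.neg_apply, ← hML m]
    exact Finset.sum_congr rfl fun d _ => hf d
  have hfl : f * ArithmeticFunction.log =
      -(ArithmeticFunction.vonMangoldt * ArithmeticFunction.vonMangoldt) := by
    rw [← ArithmeticFunction.zeta_mul_vonMangoldt, ← mul_assoc, hfz]
    exact neg_mul _ _
  have hT : ∑ d ∈ n.divisors, ((ArithmeticFunction.moebius d : ℤ) : ℝ) * Real.log d ^ 2 =
      -(ArithmeticFunction.vonMangoldt n * Real.log n) +
      (ArithmeticFunction.vonMangoldt * ArithmeticFunction.vonMangoldt) n := by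
    have h1 : (f * ArithmeticFunction.log) n = _ := congrArg (fun g => g n) hfl
    have h2 : ∑ d ∈ n.divisors, f d = -ArithmeticFunction.vonMangoldt n := by
      rw [← ArithmeticFunction.coe_mul_zeta_apply, hfz]; rfl
    rw [ArithmeticFunction.neg_apply, ArithmeticFunction.mul_apply] at h1
    rw [← neg_mul, ← h2, ← neg_eq_iff_eq_neg.mpr h1, Finset.sum_mul,
      ← Nat.sum_divisorsAntidiagonal (fun d _ => f d * Real.log n),
      ← Nat.sum_divisorsAntidiagonal
        (fun d _ => ((ArithmeticFunction.moebius d : ℤ) : ℝ) * Real.log d ^ 2),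
      ← sub_eq_add_neg, ← Finset.sum_sub_distrib]
    refine Finset.sum_congr rfl fun z hz => ?_
    rw [Nat.mem_divisorsAntidiagonal] at hz
    have h3 : (z.1 : ℝ) ≠ 0 := by
      intro h; have : z.1 = 0 := by exact_mod_cast h
      rw [this] at hz; omega
    have h4 : (z.2 : ℝ) ≠ 0 := by
      intro h; have : z.2 = 0 := by exact_mod_cast h
      rw [this] at hz; omega
    rw [hf, ArithmeticFunction.log_apply, ← hz.1]
    push_cast
    rw [Real.log_mul h3 h4]; ring
  have h0 : ∑ d ∈ n.divisors, ((ArithmeticFunction.moebius d : ℤ) : ℝ) =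
      if n = 1 then 1 else 0 := by
    rw [← sum_divisorsAntidiagonal_moebius,
      Nat.sum_divisorsAntidiagonal (fun d _ => ((ArithmeticFunction.moebius d : ℤ) : ℝ))]
  have hsplit : ∑ d ∈ n.divisors, ((ArithmeticFunction.moebius d : ℤ) : ℝ) * Real.log (x / d) ^ 2 =
      Real.log x ^ 2 * ∑ d ∈ n.divisors, ((ArithmeticFunction.moebius d : ℤ) : ℝ) -
      2 * Real.log x *
        ∑ d ∈ n.divisors, ((ArithmeticFunction.moebius d : ℤ) : ℝ) * Real.log d +
      ∑ d ∈ n.divisors, ((ArithmeticFunction.moebius d : ℤ) : ℝ) * Real.log d ^ 2 := by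
    rw [Finset.mul_sum, Finset.mul_sum, ← Finset.sum_sub_distrib, ← Finset.sum_add_distrib]
    refine Finset.sum_congr rfl fun d hd => ?_
    have hd0 : (d : ℝ) ≠ 0 := by exact_mod_cast (Nat.pos_of_mem_divisors hd).ne'
    rw [Real.log_div hx.ne' hd0]; ring
  -- The weight equals log²x · [n = 1] + 2 Λ(n) log x - Λ(n) log n + (Λ * Λ)(n); since log n ≤ log x
  -- and the other terms are nonnegative, it is at least Λ(n) log n.
  rw [hsplit, hT, h0, hML]
  have h5 : Real.log n ≤ Real.log x := Real.log_le_log (by linarith) hnx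
  have h6 : 0 ≤ ArithmeticFunction.vonMangoldt n := ArithmeticFunction.vonMangoldt_nonneg
  have h7 : 0 ≤ (ArithmeticFunction.vonMangoldt * ArithmeticFunction.vonMangoldt) n := by
    rw [ArithmeticFunction.mul_apply]
    exact Finset.sum_nonneg fun z _ => mul_nonneg ArithmeticFunction.vonMangoldt_nonneg
      ArithmeticFunction.vonMangoldt_nonneg
  have h8 : 0 ≤ Real.log x ^ 2 * (if n = 1 then 1 else 0) := by
    split_ifs <;> positivity
  nlinarith

/-- Selberg's weights are summed over y < n ≤ x. The density part carries the factor x - y; rounding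
costs at most log²(x/d) for each d, in total 32x. -/
theorem sum_Ioc_prime_sq_log_le : ∃ C : ℝ, 0 ≤ C ∧ ∀ x y : ℝ, 1 ≤ y → y ≤ x →
    ∑ p ∈ Finset.Ioc ⌊y⌋₊ ⌊x⌋₊ with p.Prime, Real.log p ^ 2
      ≤ (x - y) * (2 * Real.log x + C) + 32 * x := by
  obtain ⟨C, hC0, hC⟩ := sum_moebius_div_mul_sq_log_le
  refine ⟨C, hC0, fun x y hy hyx => ?_⟩
  have hx : 1 ≤ x := hy.trans hyx
  set N := ⌊x⌋₊ with hN
  set M := ⌊y⌋₊ with hM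
  have hMN : M ≤ N := Nat.floor_le_floor hyx
  set w : ℕ → ℝ := fun d =>
    ((ArithmeticFunction.moebius d : ℤ) : ℝ) * Real.log (x / d) ^ 2 with hw
  have key : ∀ K : ℕ, ∑ d ∈ Finset.Icc 1 K, w d * ((K / d : ℕ) : ℝ) =
      ∑ n ∈ Finset.Icc 1 K, ∑ d ∈ n.divisors, w d := by
    intro K
    have := sum_Icc_sum_Icc_div K (fun d _ => w d)
    simp only [Finset.sum_const, Nat.card_Icc, add_tsub_cancel_right, nsmul_eq_mul] at this
    rw [Finset.sum_congr rfl (fun d _ => mul_comm _ _), this]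
    exact Finset.sum_congr rfl fun k _ => Nat.sum_divisorsAntidiagonal (fun a _ => w a)
  -- For M < d ≤ N the quotient `M / d` is 0, so both sums may run over the same d.
  have keyM : ∑ d ∈ Finset.Icc 1 M, w d * ((M / d : ℕ) : ℝ) =
      ∑ d ∈ Finset.Icc 1 N, w d * ((M / d : ℕ) : ℝ) := by
    refine Finset.sum_subset (Finset.Icc_subset_Icc_right hMN) fun d hd hd2 => ?_
    rw [Finset.mem_Icc] at hd hd2
    rw [Nat.div_eq_of_lt (by omega)]; simp
  have hsum : ∑ n ∈ Finset.Ioc M N, ∑ d ∈ n.divisors, w d =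
      ∑ d ∈ Finset.Icc 1 N, w d * (((N / d : ℕ) : ℝ) - ((M / d : ℕ) : ℝ)) := by
    simp only [mul_sub]
    rw [Finset.sum_sub_distrib, key N, ← keyM, key M, eq_sub_iff_add_eq, add_comm]
    have hu : Finset.Icc 1 N = Finset.Icc 1 M ∪ Finset.Ioc M N := by
      ext n; simp only [Finset.mem_union, Finset.mem_Icc, Finset.mem_Ioc]; omega
    rw [hu, Finset.sum_union]
    rw [Finset.disjoint_left]
    intro n h1 h2
    rw [Finset.mem_Icc] at h1; rw [Finset.mem_Ioc] at h2; omega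
  calc _ ≤ ∑ n ∈ Finset.Ioc M N, ArithmeticFunction.vonMangoldt n * Real.log n := by
        rw [Finset.sum_filter]
        refine Finset.sum_le_sum fun n hn => ?_
        rw [Finset.mem_Ioc] at hn
        have h1 : (1 : ℝ) ≤ n := by exact_mod_cast (by omega : 1 ≤ n)
        split_ifs with hp
        · rw [ArithmeticFunction.vonMangoldt_apply_prime hp, sq]
        · exact mul_nonneg ArithmeticFunction.vonMangoldt_nonneg (Real.log_nonneg h1)
    _ ≤ ∑ n ∈ Finset.Ioc M N, ∑ d ∈ n.divisors, w d := by
        refine Finset.sum_le_sum fun n hn => ?_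
        rw [Finset.mem_Ioc] at hn
        exact vonMangoldt_mul_log_le_sum (by omega) ((Nat.le_floor_iff (by linarith)).mp hn.2)
    _ = _ := hsum
    _ ≤ ∑ d ∈ Finset.Icc 1 N, ((x - y) * (((ArithmeticFunction.moebius d : ℤ) : ℝ) / d *
          Real.log (x / d) ^ 2) + Real.log (x / d) ^ 2) := by
        refine Finset.sum_le_sum fun d _ => ?_
        obtain ⟨h1, h2⟩ := natCast_floor_div_bounds (x := x) (by linarith) (d := d)
        obtain ⟨h3, h4⟩ := natCast_floor_div_bounds (x := y) (by linarith) (d := d)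
        have h5 : |((ArithmeticFunction.moebius d : ℤ) : ℝ) *
            (((N / d : ℕ) : ℝ) - ((M / d : ℕ) : ℝ) - (x / d - y / d))| ≤ 1 := by
          rw [abs_mul]
          refine mul_le_one₀ (abs_moebius_cast_le_one d) (abs_nonneg _) ?_
          rw [abs_le]; constructor <;> linarith
        have h6 := mul_le_mul_of_nonneg_right (abs_le.mp h5).2 (sq_nonneg (Real.log (x / d)))
        have h7 : w d * (((N / d : ℕ) : ℝ) - ((M / d : ℕ) : ℝ)) =
          (x - y) * (((ArithmeticFunction.moebius d : ℤ) : ℝ) / d *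
          Real.log (x / d) ^ 2) + ((ArithmeticFunction.moebius d : ℤ) : ℝ) *
            (((N / d : ℕ) : ℝ) - ((M / d : ℕ) : ℝ) - (x / d - y / d)) * Real.log (x / d) ^ 2 := by
          simp only [hw]; ring
        rw [h7]; linarith
    _ ≤ _ := by
        rw [Finset.sum_add_distrib, ← Finset.mul_sum]
        have h1 := mul_le_mul_of_nonneg_left (hC x hx) (sub_nonneg.mpr hyx)
        linarith [sum_sq_log_div_le hx]

/-- Each prime here has p⁻¹ ≤ log²p / (y log²y). Selberg's bound makes the sum about 2δ / log y for
an interval (y, (1 + δ)y], the term 32x being of lower order, so a small δ beats any κ. -/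
theorem sum_inv_prime_short_interval_le {κ : ℝ} (hκ : 0 < κ) : ∃ ε > 0, ∃ Y : ℝ, 2 ≤ Y ∧
    ∀ y ≥ Y, ∑ p ∈ Finset.Ioc ⌊y⌋₊ ⌊y * Real.exp ε⌋₊ with p.Prime, (p : ℝ)⁻¹
      ≤ κ / Real.log y := by
  obtain ⟨C, hC0, hC⟩ := sum_Ioc_prime_sq_log_le
  set δ := min (κ / 8) 1 with hδ
  have hδ0 : 0 < δ := lt_min (by positivity) one_pos
  have hδ1 : δ ≤ 1 := min_le_right _ _
  have hδκ : δ ≤ κ / 8 := min_le_left _ _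
  -- The threshold makes 66 + C ≤ (κ/2) log y: 64 comes from 32x ≤ 64y, and 2 + C from δ(2 + C) ≤ 2
  -- + C after log x ≤ log y + 1.
  refine ⟨Real.log (1 + δ), Real.log_pos (by linarith), max 2 (Real.exp ((66 + C) / (κ / 2))),
    le_max_left _ _, fun y hy => ?_⟩
  have hy2 : 2 ≤ y := (le_max_left _ _).trans hy
  have hly : (66 + C) / (κ / 2) ≤ Real.log y := by
    rw [Real.le_log_iff_exp_le (by linarith)]
    exact (le_max_right _ _).trans hy
  have hly0 : 0 < Real.log y := Real.log_pos (by linarith)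
  rw [div_le_iff₀ (by positivity)] at hly
  rw [Real.exp_log (by linarith)]
  set x := y * (1 + δ) with hx
  have hyx : y ≤ x := by rw [hx]; nlinarith
  have hx2 : x ≤ 2 * y := by rw [hx]; nlinarith
  have hlx : Real.log x ≤ Real.log y + 1 := by
    rw [hx, Real.log_mul (by linarith) (by linarith)]
    have := Real.log_le_sub_one_of_pos (show 0 < 1 + δ by linarith)
    linarith
  have h1 := hC x y (by linarith) hyx
  have h2 : ∑ p ∈ Finset.Ioc ⌊y⌋₊ ⌊x⌋₊ with p.Prime, (p : ℝ)⁻¹ ≤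
      (∑ p ∈ Finset.Ioc ⌊y⌋₊ ⌊x⌋₊ with p.Prime, Real.log p ^ 2) / (y * Real.log y ^ 2) := by
    rw [Finset.sum_div]
    refine Finset.sum_le_sum fun p hp => ?_
    rw [Finset.mem_filter, Finset.mem_Ioc] at hp
    have h3 : y < p := Nat.lt_of_floor_lt hp.1.1
    have h4 : Real.log y ≤ Real.log p := Real.log_le_log (by linarith) h3.le
    have hp0 : (0 : ℝ) < p := by linarith
    rw [inv_eq_one_div, div_le_div_iff₀ hp0 (by positivity), one_mul]
    rw [mul_comm (Real.log p ^ 2)]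
    gcongr
  refine h2.trans ?_
  rw [div_le_div_iff₀ (by positivity) hly0]
  have h5 : (x - y) * (2 * Real.log x + C) + 32 * x ≤ κ * y * Real.log y := by
    have : x - y = y * δ := by rw [hx]; ring
    rw [this]
    have h6 : δ * (2 * Real.log x + C) ≤ κ / 8 * (2 * Real.log y) + (2 + C) := by
      have h7 : δ * (2 * Real.log x + C) ≤ δ * (2 * Real.log y) + δ * (2 + C) := by nlinarith
      have h8 : δ * (2 + C) ≤ 1 * (2 + C) := by gcongr
      have h9 : δ * (2 * Real.log y) ≤ κ / 8 * (2 * Real.log y) := by gcongr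
      linarith
    have h10 : y * (δ * (2 * Real.log x + C) + 64) ≤ y * (κ * Real.log y) := by
      gcongr
      nlinarith
    nlinarith
  calc _ ≤ (κ * y * Real.log y) * Real.log y := by gcongr; exact h1.trans h5
    _ = _ := by ring

/-! ### Chebyshev windows and pairs of primes at controlled distance. -/

theorem eventually_half_mul_le_theta : ∀ᶠ x : ℝ in Filter.atTop, x / 2 ≤ Chebyshev.theta x := by
  have h := (isLittleO_log_rpow_atTop (show (0 : ℝ) < 1 / 2 by norm_num)).bound
    (show (0 : ℝ) < 1 / 40 by norm_num)
  filter_upwards [h, Filter.eventually_ge_atTop 10] with x hx hx10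
  have h0 := Real.log_nonneg (show 1 ≤ x by linarith)
  rw [Real.norm_of_nonneg h0, ← Real.sqrt_eq_rpow, Real.norm_of_nonneg (Real.sqrt_nonneg _)] at hx
  have h1 : √x * √x = x := Real.mul_self_sqrt (by linarith)
  have h2 : 1 ≤ √x := Real.one_le_sqrt.mpr (by linarith)
  have h3 : Real.log (x + 2) ≤ 2 * Real.log x := by
    rw [← Real.log_rpow (by linarith)]
    refine Real.log_le_log (by linarith) ?_
    norm_num; nlinarith
  have h4 := Chebyshev.theta_ge' (show 1 ≤ x by linarith)
  have h5 := Real.log_two_gt_d9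
  have h6 : √x * Real.log x ≤ x / 40 := by nlinarith
  have h7 : Real.log x ≤ x / 40 := by nlinarith
  nlinarith

/-- The ratio e² is large enough for Chebyshev's lower constant 1/2 to beat the upper constant log
4: θ(e²y) - θ(y) ≥ (7/2 - 1.4) y ≥ y. With x = e²y ≤ 8y and log x = 2k + 2 ≤ 4k this yields c =
1/32. -/
theorem sum_inv_prime_window_ge : ∃ c > 0, ∃ k₀ : ℕ, 1 ≤ k₀ ∧ ∀ k : ℕ, k₀ ≤ k →
    c / (k : ℝ) ≤ ∑ p ∈ Finset.Ioc ⌊Real.exp (2 * k)⌋₊ ⌊Real.exp (2 * (k + 1 : ℕ))⌋₊ with p.Prime,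
      (p : ℝ)⁻¹ := by
  have hten : Filter.Tendsto (fun k : ℕ => Real.exp (2 * (k + 1 : ℕ))) Filter.atTop
      Filter.atTop := by
    refine Real.tendsto_exp_atTop.comp ?_
    refine Filter.Tendsto.const_mul_atTop two_pos ?_
    exact tendsto_natCast_atTop_atTop.comp (Filter.tendsto_add_atTop_nat 1)
  obtain ⟨k₀, hk₀⟩ := Filter.eventually_atTop.mp (hten.eventually eventually_half_mul_le_theta)
  refine ⟨1 / 32, by norm_num, max k₀ 1, le_max_right _ _, fun k hk => ?_⟩
  have hk1 : (1 : ℝ) ≤ k := by exact_mod_cast (le_max_right k₀ 1).trans hk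
  have h1 := hk₀ k ((le_max_left _ _).trans hk)
  set y := Real.exp (2 * k) with hy
  have hy0 : 0 < y := Real.exp_pos _
  have hxy : Real.exp (2 * (k + 1 : ℕ)) = y * Real.exp 2 := by
    rw [hy, ← Real.exp_add]; push_cast; ring_nf
  have he1 : (7 : ℝ) ≤ Real.exp 2 := by
    have := Real.exp_one_gt_d9
    have h : Real.exp 2 = Real.exp 1 * Real.exp 1 := by rw [← Real.exp_add]; norm_num
    nlinarith
  have he2 : Real.exp 2 ≤ 8 := by
    have := Real.exp_one_lt_d9
    have h0 := Real.exp_pos 1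
    have h : Real.exp 2 = Real.exp 1 * Real.exp 1 := by rw [← Real.exp_add]; norm_num
    nlinarith
  rw [hxy] at h1 ⊢
  set x := y * Real.exp 2 with hx
  have hyx : y ≤ x := by rw [hx]; nlinarith
  have h2 := Chebyshev.theta_le_log4_mul_x hy0.le
  have hl4 : Real.log 4 < 1.4 := by
    have : Real.log 4 = 2 * Real.log 2 := by
      rw [show (4 : ℝ) = 2 ^ 2 by norm_num, Real.log_pow]; norm_num
    rw [this]; have := Real.log_two_lt_d9; linarith
  have h3 : y ≤ Chebyshev.theta x - Chebyshev.theta y := by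
    have : x ≥ 7 * y := by rw [hx]; nlinarith
    nlinarith
  have h4 : Chebyshev.theta x - Chebyshev.theta y =
      ∑ p ∈ Finset.Ioc ⌊y⌋₊ ⌊x⌋₊ with p.Prime, Real.log p := by
    rw [Chebyshev.theta, Chebyshev.theta, Finset.sum_filter, Finset.sum_filter, Finset.sum_filter,
      sub_eq_iff_eq_add, add_comm]
    exact (Finset.sum_Ioc_consecutive _ (Nat.zero_le _) (Nat.floor_le_floor hyx)).symm
  have hlx : Real.log x = 2 * k + 2 := by
    rw [← hxy, Real.log_exp]; push_cast; ring
  have h5 : ∑ p ∈ Finset.Ioc ⌊y⌋₊ ⌊x⌋₊ with p.Prime, Real.log p ≤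
      (x * Real.log x) * ∑ p ∈ Finset.Ioc ⌊y⌋₊ ⌊x⌋₊ with p.Prime, (p : ℝ)⁻¹ := by
    rw [Finset.mul_sum]
    refine Finset.sum_le_sum fun p hp => ?_
    rw [Finset.mem_filter, Finset.mem_Ioc] at hp
    have h3 : (p : ℝ) ≤ x := (Nat.le_floor_iff (by linarith)).mp hp.1.2
    have hp0 : (0 : ℝ) < p := by exact_mod_cast hp.2.pos
    have h4 : Real.log p ≤ Real.log x := Real.log_le_log hp0 h3
    rw [← div_eq_mul_inv, le_div_iff₀ hp0, mul_comm]
    exact mul_le_mul h3 h4 (Real.log_nonneg (by exact_mod_cast hp.2.one_le)) (by linarith)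
  set S := ∑ p ∈ Finset.Ioc ⌊y⌋₊ ⌊x⌋₊ with p.Prime, (p : ℝ)⁻¹ with hS
  have hS0 : 0 ≤ S := Finset.sum_nonneg fun p _ => by positivity
  have h6 : y * 1 ≤ y * (8 * (4 * k) * S) := by
    calc y * 1 ≤ x * Real.log x * S := by linarith
      _ ≤ (y * 8) * (4 * k) * S := by
        rw [hlx, hx]; gcongr; linarith
      _ = _ := by ring
  have h7 := le_of_mul_le_mul_left h6 hy0
  rw [div_le_iff₀ (by linarith)]
  linarith

/-- Suppose no pair exists. Cut each window e^{2k} < p ≤ e^{2k+2} into cells of logarithmic length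
at most η. The primes of `G` in a cell lie within ε of the smallest one, so by the sieve they carry
little reciprocal mass, and at least half of the window's mass lies outside `G`. Summing c/(2k) over
k contradicts the bound `K`. It is essential that ε precedes `K` and `G`. -/
theorem exists_good_prime_pair {η : ℝ} (hη : 0 < η) : ∃ ε > 0, ∀ (K : ℝ) (G : Set ℕ),
    (∀ S : Finset ℕ, (∀ p ∈ S, p.Prime ∧ p ∉ G) → ∑ p ∈ S, (p : ℝ)⁻¹ ≤ K) →
    ∃ p ∈ G, ∃ q ∈ G, p.Prime ∧ q.Prime ∧ ε ≤ Real.log q - Real.log p ∧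
      Real.log q - Real.log p ≤ η := by
  classical
  obtain ⟨c, hc, k₀, hk₀, hwin⟩ := sum_inv_prime_window_ge
  set M := ⌈2 / η⌉₊ with hM
  have hM0 : 0 < M := Nat.ceil_pos.mpr (by positivity)
  have hMr : (0 : ℝ) < M := by exact_mod_cast hM0
  have hMη : 2 / (M : ℝ) ≤ η := by
    rw [div_le_iff₀ hMr]
    have := Nat.le_ceil (2 / η)
    rw [div_le_iff₀ hη] at this
    linarith
  -- `M + 1` cells of mass at most κ/k each make up c/(2k), half of the guaranteed window mass. The
  -- extra cell is there because the upper bound log p ≤ 2k + 2 is not strict.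
  set κ := c / (2 * (M + 1)) with hκ
  have hκ0 : 0 < κ := by positivity
  obtain ⟨ε, hε, Y, hY2, hY⟩ := sum_inv_prime_short_interval_le hκ0
  refine ⟨ε, hε, fun K G hK => ?_⟩
  by_contra! hno
  -- far out, a single reciprocal is negligible
  have hev : ∀ᶠ y : ℝ in Filter.atTop, Real.log y ≤ κ * y ∧ Y ≤ y := by
    refine Filter.Eventually.and ?_ (Filter.eventually_ge_atTop Y)
    have := Real.isLittleO_log_id_atTop.bound hκ0
    filter_upwards [this, Filter.eventually_ge_atTop 1] with y h1 h2
    rw [Real.norm_of_nonneg (Real.log_nonneg h2), id, Real.norm_of_nonneg (by linarith)] at h1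
    exact h1
  obtain ⟨Y₁, hY₁⟩ := Filter.eventually_atTop.mp hev
  have hten : Filter.Tendsto (fun k : ℕ => Real.exp (2 * k)) Filter.atTop Filter.atTop :=
    Real.tendsto_exp_atTop.comp
      (Filter.Tendsto.const_mul_atTop two_pos tendsto_natCast_atTop_atTop)
  obtain ⟨k₁, hk₁⟩ := Filter.eventually_atTop.mp (hten.eventually (Filter.eventually_ge_atTop Y₁))
  set f : ℕ → ℕ := fun k => ⌊Real.exp (2 * k)⌋₊ with hf
  have hgood : ∀ k, max k₀ k₁ ≤ k → ∑ p ∈ Finset.Ioc (f k) (f (k + 1)) with p.Prime ∧ p ∈ G,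
      (p : ℝ)⁻¹ ≤ c / (2 * k) := by
    intro k hk
    have hk1 : (1 : ℝ) ≤ k := by exact_mod_cast hk₀.trans ((le_max_left _ _).trans hk)
    set φ : ℕ → ℕ := fun p => ⌊(Real.log p - 2 * k) * (M / 2)⌋₊ with hφ
    set W := {p ∈ Finset.Ioc (f k) (f (k + 1)) | p.Prime ∧ p ∈ G} with hW
    have hWmem : ∀ p ∈ W, p.Prime ∧ p ∈ G ∧ Real.exp (2 * k) < p ∧ 2 * k < Real.log p ∧
        Real.log p ≤ 2 * k + 2 := by
      intro p hp
      rw [hW, Finset.mem_filter, Finset.mem_Ioc] at hp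
      have h1 : Real.exp (2 * k) < p := Nat.lt_of_floor_lt hp.1.1
      have h2 : (p : ℝ) ≤ Real.exp (2 * (k + 1 : ℕ)) :=
        (Nat.le_floor_iff (Real.exp_pos _).le).mp hp.1.2
      have hp0 : (0 : ℝ) < p := (Real.exp_pos _).trans h1
      refine ⟨hp.2.1, hp.2.2, h1, (Real.lt_log_iff_exp_lt hp0).mpr h1, ?_⟩
      have := (Real.log_le_iff_le_exp hp0).mpr h2
      push_cast at this; linarith
    have hmaps : ∀ p ∈ W, φ p ∈ Finset.range (M + 1) := by
      intro p hp
      obtain ⟨-, -, -, h1, h2⟩ := hWmem p hp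
      rw [Finset.mem_range, Nat.lt_succ_iff]
      refine Nat.floor_le_of_le ?_
      nlinarith
    rw [← Finset.sum_fiberwise_of_maps_to hmaps]
    have hfib : ∀ i ∈ Finset.range (M + 1), ∑ p ∈ W with φ p = i, (p : ℝ)⁻¹ ≤ κ / k := by
      intro i _
      rcases Finset.eq_empty_or_nonempty {p ∈ W | φ p = i} with h0 | hne
      · rw [h0, Finset.sum_empty]; positivity
      set p₀ := Finset.min' _ hne with hp₀
      have hp₀m := Finset.min'_mem _ hne
      rw [← hp₀, Finset.mem_filter] at hp₀m
      obtain ⟨hpr, hG, hexp, hlog1, hlog2⟩ := hWmem p₀ hp₀m.1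
      have hp0 : (0 : ℝ) < p₀ := (Real.exp_pos _).trans hexp
      have hsub : {p ∈ W | φ p = i} ⊆
          insert p₀ {p ∈ Finset.Ioc ⌊(p₀ : ℝ)⌋₊ ⌊(p₀ : ℝ) * Real.exp ε⌋₊ | p.Prime} := by
        intro p hp
        have hle := Finset.min'_le _ p hp
        rw [← hp₀] at hle
        rw [Finset.mem_filter] at hp
        obtain ⟨hpr', hG', hexp', hlog1', hlog2'⟩ := hWmem p hp.1
        have hpp : (0 : ℝ) < p := (Real.exp_pos _).trans hexp'
        rcases hle.eq_or_lt with h | h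
        · rw [← h]; exact Finset.mem_insert_self _ _
        refine Finset.mem_insert_of_mem ?_
        have hclose : Real.log p - Real.log p₀ ≤ η := by
          refine le_trans ?_ hMη
          have h1 : φ p = φ p₀ := hp.2.trans hp₀m.2.symm
          have h2 := Nat.lt_floor_add_one ((Real.log p - 2 * k) * (M / 2))
          have h3 := Nat.floor_le (show 0 ≤ (Real.log p₀ - 2 * k) * (M / 2 : ℝ) from
            mul_nonneg (by linarith) (by positivity))
          simp only [hφ] at h1
          rw [h1] at h2
          rw [le_div_iff₀ hMr]
          nlinarith
        have hlt : Real.log p - Real.log p₀ < ε := by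
          by_contra! hcon
          exact absurd hclose (not_le.mpr (hno p₀ hG p hG' hpr hpr' hcon))
        rw [Finset.mem_filter, Finset.mem_Ioc, Nat.floor_natCast]
        refine ⟨⟨h, Nat.le_floor ?_⟩, hpr'⟩
        rw [← Real.log_le_log_iff hpp (by positivity), Real.log_mul hp0.ne' (Real.exp_pos _).ne',
          Real.log_exp]
        linarith
      have hY1 : Y₁ ≤ p₀ := (hk₁ k ((le_max_right _ _).trans hk)).trans hexp.le
      obtain ⟨hsmall, hYp⟩ := hY₁ p₀ hY1
      have hlp : 0 < Real.log p₀ := by linarith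
      calc _ ≤ ∑ p ∈ insert p₀ {p ∈ Finset.Ioc ⌊(p₀ : ℝ)⌋₊ ⌊(p₀ : ℝ) * Real.exp ε⌋₊ | p.Prime},
            (p : ℝ)⁻¹ := Finset.sum_le_sum_of_subset_of_nonneg hsub fun p _ _ => by positivity
        _ ≤ (p₀ : ℝ)⁻¹ + κ / Real.log p₀ := by
          rw [Finset.sum_insert (by simp)]
          gcongr
          exact hY p₀ hYp
        -- The smallest prime of the cell is not in the half-open interval of the sieve bound; its
        -- own reciprocal is at most κ / log p₀ since p₀ is large.
        _ ≤ κ / Real.log p₀ + κ / Real.log p₀ := by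
          gcongr
          rw [inv_eq_one_div, div_le_div_iff₀ hp0 hlp]; linarith
        _ ≤ κ / (2 * k) + κ / (2 * k) := by gcongr
        _ = κ / k := by field_simp; norm_num
    refine (Finset.sum_le_sum hfib).trans (le_of_eq ?_)
    rw [Finset.sum_const, Finset.card_range, nsmul_eq_mul, hκ]
    push_cast; field_simp
  set g : ℕ → ℝ := fun p => if p.Prime ∧ p ∉ G then (p : ℝ)⁻¹ else 0 with hg
  have hbad : ∀ k, max k₀ k₁ ≤ k → c / 2 * (1 / (k : ℝ)) ≤ ∑ p ∈ Finset.Ioc (f k) (f (k + 1)), g p := by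
    intro k hk
    have h1 := hwin k ((le_max_left _ _).trans hk)
    have h2 := hgood k hk
    have h3 : ∑ p ∈ Finset.Ioc (f k) (f (k + 1)) with p.Prime, (p : ℝ)⁻¹ =
        ∑ p ∈ Finset.Ioc (f k) (f (k + 1)) with p.Prime ∧ p ∈ G, (p : ℝ)⁻¹ +
        ∑ p ∈ Finset.Ioc (f k) (f (k + 1)), g p := by
      rw [Finset.sum_filter, Finset.sum_filter, ← Finset.sum_add_distrib]
      refine Finset.sum_congr rfl fun p _ => ?_
      by_cases h1 : p.Prime <;> by_cases h2 : p ∈ G <;> simp [hg, h1, h2]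
    have h4 : c / (2 * (k : ℝ)) = c / 2 * (1 / k) := by ring
    have h5 : c / (k : ℝ) = c / 2 * (1 / k) + c / 2 * (1 / k) := by ring
    rw [h4] at h2
    rw [h5] at h1
    change _ ≤ ∑ p ∈ Finset.Ioc (f k) (f (k + 1)) with p.Prime, (p : ℝ)⁻¹ at h1
    rw [h3] at h1
    linarith
  have hfm : Monotone f := fun a b hab => Nat.floor_le_floor (by gcongr)
  have htel : ∀ n, max k₀ k₁ ≤ n → ∑ k ∈ Finset.Ico (max k₀ k₁) n, c / 2 * (1 / (k : ℝ)) ≤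
      ∑ p ∈ Finset.Ioc (f (max k₀ k₁)) (f n), g p := by
    intro n hn
    induction n, hn using Nat.le_induction with
    | base => simp
    | succ n hn ih =>
      rw [Finset.sum_Ico_succ_top hn, ← Finset.sum_Ioc_consecutive g (hfm hn) (hfm (Nat.le_succ n))]
      exact add_le_add ih (hbad n hn)
  have hKb : ∀ a b, ∑ p ∈ Finset.Ioc a b, g p ≤ K := by
    intro a b
    rw [hg, ← Finset.sum_filter]
    exact hK _ fun p hp => (Finset.mem_filter.mp hp).2
  have hdiv := (not_summable_iff_tendsto_nat_atTop_of_nonneg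
    (fun n : ℕ => by positivity)).mp Real.not_summable_one_div_natCast
  obtain ⟨n, hn1, hn2⟩ := ((hdiv.eventually_gt_atTop
    (K / (c / 2) + ∑ k ∈ Finset.range (max k₀ k₁), 1 / (k : ℝ))).and
    (Filter.eventually_ge_atTop (max k₀ k₁))).exists
  have h1 := (htel n hn2).trans (hKb _ _)
  rw [← Finset.mul_sum, Finset.sum_Ico_eq_sub _ hn2, mul_comm, ← le_div_iff₀ (by positivity)] at h1
  linarith

/-! ### Rigidity of Lipschitz functions related by prime shifts. -/

/-- If both p and q are good, F(r) ≈ G(r - log p) ≈ F(r + log q - log p). Goodness is tested on a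
finite grid and extended by the Lipschitz bounds; primes failing somewhere on the grid have bounded
reciprocal sum. The lower bound ε on the period does not depend on the error ζ. -/
theorem exists_almost_period {F G : ℝ → ℝ} {L K : ℝ} (hL : 0 ≤ L)
    (hF : ∀ s t, |F s - F t| ≤ L * |s - t|) (hG : ∀ s t, |G s - G t| ≤ L * |s - t|)
    (h : ∀ s, ∀ S : Finset ℕ, (∀ p ∈ S, p.Prime) →
      ∑ p ∈ S, (p : ℝ)⁻¹ * (F s - G (s - Real.log p)) ^ 2 ≤ K) {η : ℝ} (hη : 0 < η) :
    ∃ ε > 0, ∀ s t ζ : ℝ, 0 < ζ → ∃ δ, ε ≤ δ ∧ δ ≤ η ∧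
      ∀ r, s ≤ r → r ≤ t → |F (r + δ) - F r| ≤ ζ := by
  obtain ⟨ε, hε, hpair⟩ := exists_good_prime_pair hη
  refine ⟨ε, hε, fun s t ζ hζ => ?_⟩
  set m := ζ / (10 * (L + 1)) with hm
  have hm0 : 0 < m := by positivity
  have hLm : L * m ≤ ζ / 10 := by
    rw [hm, mul_div_assoc', div_le_div_iff₀ (by positivity) (by norm_num)]; nlinarith
  -- The grid reaches `t + η` because F is also compared at r + δ, with δ ≤ η.
  set n := ⌊(t + η - s) / m⌋₊ with hn
  set G₀ : Set ℕ := {p | ∀ i ∈ Finset.range (n + 1),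
    |F (s + i * m) - G (s + i * m - Real.log p)| ≤ ζ / 10} with hG₀
  have hbad : ∀ S : Finset ℕ, (∀ p ∈ S, p.Prime ∧ p ∉ G₀) →
      ∑ p ∈ S, (p : ℝ)⁻¹ ≤ (n + 1) * K * (100 / ζ ^ 2) := by
    intro S hS
    calc ∑ p ∈ S, (p : ℝ)⁻¹ ≤ ∑ p ∈ S, ∑ i ∈ Finset.range (n + 1),
          (p : ℝ)⁻¹ * (F (s + i * m) - G (s + i * m - Real.log p)) ^ 2 * (100 / ζ ^ 2) := by
          refine Finset.sum_le_sum fun p hp => ?_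
          have h1 := (hS p hp).2
          simp only [hG₀, Set.mem_ofPred_eq, not_forall, not_le] at h1
          obtain ⟨i, hi, hlt⟩ := h1
          refine le_trans ?_ (Finset.single_le_sum (f := fun i : ℕ =>
            (p : ℝ)⁻¹ * (F (s + i * m) - G (s + i * m - Real.log p)) ^ 2 * (100 / ζ ^ 2))
            (fun j _ => by positivity) hi)
          have h2 : (ζ / 10) ^ 2 ≤ (F (s + i * m) - G (s + i * m - Real.log p)) ^ 2 := by
            rw [← sq_abs (F _ - _)]; gcongr
          calc (p : ℝ)⁻¹ = (p : ℝ)⁻¹ * (ζ / 10) ^ 2 * (100 / ζ ^ 2) := by field_simp; norm_num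
            _ ≤ _ := by gcongr
      _ = ∑ i ∈ Finset.range (n + 1), (∑ p ∈ S,
          (p : ℝ)⁻¹ * (F (s + i * m) - G (s + i * m - Real.log p)) ^ 2) * (100 / ζ ^ 2) := by
          rw [Finset.sum_comm]; simp only [Finset.sum_mul]
      _ ≤ ∑ i ∈ Finset.range (n + 1), K * (100 / ζ ^ 2) := by
          refine Finset.sum_le_sum fun i _ => ?_
          gcongr
          exact h _ S fun p hp => (hS p hp).1
      _ = _ := by simp; ring
  obtain ⟨p, hp, q, hq, hpp, hqp, h1, h2⟩ := hpair _ G₀ hbad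
  -- One ζ/10 from the nearest grid point to the left, one each from moving F and G there.
  have key : ∀ p ∈ G₀, ∀ r, s ≤ r → r ≤ t + η → |F r - G (r - Real.log p)| ≤ ζ / 10 * 3 := by
    intro p hp r hr1 hr2
    set i := ⌊(r - s) / m⌋₊ with hi
    have hin : i ∈ Finset.range (n + 1) := by
      rw [Finset.mem_range, Nat.lt_succ_iff]
      exact Nat.floor_le_floor (by gcongr)
    have h3 := Nat.floor_le (show 0 ≤ (r - s) / m from div_nonneg (by linarith) hm0.le)
    have h4 := Nat.lt_floor_add_one ((r - s) / m)
    rw [← hi] at h3 h4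
    rw [le_div_iff₀ hm0] at h3
    rw [div_lt_iff₀ hm0] at h4
    have h5 : |r - (s + i * m)| ≤ m := by rw [abs_le]; constructor <;> linarith
    have h6 := hp i hin
    have h7 := hF r (s + i * m)
    have h8 := hG (r - Real.log p) (s + i * m - Real.log p)
    rw [sub_sub_sub_cancel_right] at h8
    have h9 : L * |r - (s + i * m)| ≤ ζ / 10 := (mul_le_mul_of_nonneg_left h5 hL).trans hLm
    rw [abs_le] at h6 ⊢
    have h10 := abs_le.mp (h7.trans h9)
    have h11 := abs_le.mp (h8.trans h9)
    constructor <;> linarith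
  refine ⟨_, h1, h2, fun r hr1 hr2 => ?_⟩
  have h3 := key p hp r hr1 (by linarith)
  have h4 := key q hq (r + (Real.log q - Real.log p)) (by linarith) (by linarith)
  rw [show r + (Real.log q - Real.log p) - Real.log q = r - Real.log p by ring] at h4
  rw [abs_le] at h3 h4 ⊢
  constructor <;> linarith

/-- Walk from s towards t in steps of an almost period δ ≥ ε: there are at most (t - s)/ε steps, so
their errors total O(ζ/ε), negligible as ζ → 0 with ε fixed. The last incomplete step costs at most
Lη, and η is arbitrary. -/
theorem eq_of_prime_shift {F G : ℝ → ℝ} {L K : ℝ} (hL : 0 ≤ L)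
    (hF : ∀ s t, |F s - F t| ≤ L * |s - t|) (hG : ∀ s t, |G s - G t| ≤ L * |s - t|)
    (h : ∀ s, ∀ S : Finset ℕ, (∀ p ∈ S, p.Prime) →
      ∑ p ∈ S, (p : ℝ)⁻¹ * (F s - G (s - Real.log p)) ^ 2 ≤ K) (s t : ℝ) : F s = F t := by
  wlog hst : s ≤ t generalizing s t
  · exact (this t s (by linarith)).symm
  have main : ∀ η > 0, |F t - F s| ≤ L * η := by
    intro η hη
    obtain ⟨ε, hε, hper⟩ := exists_almost_period hL hF hG h hη
    refine le_of_forall_pos_le_add fun ξ hξ => ?_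
    set ζ := ξ * ε / (t - s + 1) with hζ
    have hts : 0 < t - s + 1 := by linarith
    have hζ0 : 0 < ζ := by positivity
    obtain ⟨δ, h1, h2, h3⟩ := hper s t ζ hζ0
    have hδ : 0 < δ := hε.trans_le h1
    have hiter : ∀ k : ℕ, s + k * δ ≤ t → |F (s + k * δ) - F s| ≤ k * ζ := by
      intro k
      induction k with
      | zero => simp
      | succ k ih =>
        intro hk
        push_cast at hk ⊢
        have h4 : s + k * δ ≤ t := by nlinarith
        have h5 := ih h4
        have h6 := h3 (s + k * δ) (by have : 0 ≤ (k : ℝ) * δ := by positivity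
                                      linarith) h4
        rw [show s + (k + 1) * δ = s + k * δ + δ by ring]
        rw [abs_le] at h5 h6 ⊢
        constructor <;> linarith
    set k := ⌊(t - s) / δ⌋₊ with hk
    have h4 := Nat.floor_le (show 0 ≤ (t - s) / δ from div_nonneg (by linarith) hδ.le)
    have h5 := Nat.lt_floor_add_one ((t - s) / δ)
    rw [← hk] at h4 h5
    rw [div_lt_iff₀ hδ] at h5
    rw [le_div_iff₀ hδ] at h4
    have h6 := hiter k (by linarith)
    have h7 : k * ζ ≤ ξ := by
      have : (k : ℝ) * ε ≤ t - s + 1 := by nlinarith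
      rw [hζ, mul_div_assoc', div_le_iff₀ hts]
      nlinarith
    have h8 := hF t (s + k * δ)
    have h9 : |t - (s + k * δ)| ≤ η := by rw [abs_le]; constructor <;> linarith
    have h10 := h8.trans (mul_le_mul_of_nonneg_left h9 hL)
    rw [abs_le] at h6 h10 ⊢
    constructor <;> linarith
  have h0 : |F t - F s| ≤ 0 := by
    refine le_of_forall_pos_le_add fun ξ hξ => ?_
    refine (main (ξ / (L + 1)) (by positivity)).trans ?_
    rw [mul_div_assoc', div_le_iff₀ (by positivity)]
    nlinarith
  have := abs_nonpos_iff.mp h0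
  linarith

theorem eq_of_prime_shift_of_const {F G : ℝ → ℝ} {K : ℝ}
    (hG : ∀ s t, G s = G t)
    (h : ∀ s, ∀ S : Finset ℕ, (∀ p ∈ S, p.Prime) →
      ∑ p ∈ S, (p : ℝ)⁻¹ * (F s - G (s - Real.log p)) ^ 2 ≤ K) : F 0 = G 0 := by
  by_contra hne
  have hd : 0 < (F 0 - G 0) ^ 2 := by
    have := sub_ne_zero.mpr hne
    positivity
  -- Applied to the empty set of good primes, the lemma merely expresses the divergence of ∑ 1/p.
  obtain ⟨ε, -, hpair⟩ := exists_good_prime_pair one_pos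
  obtain ⟨p, hp, -⟩ := hpair (K / (F 0 - G 0) ^ 2) ∅ fun S hS => by
    rw [le_div_iff₀ hd, Finset.sum_mul]
    refine le_trans (le_of_eq (Finset.sum_congr rfl fun p _ => ?_)) (h 0 S fun p hp => (hS p hp).1)
    rw [hG (0 - Real.log p) 0]
  exact hp

/-! ### Mean values and the dual Turán–Kubilius inequality. -/

/-- The average of `b` over the positive integers up to `x`. -/
noncomputable def meanUpTo (b : ℕ → ℝ) (x : ℝ) : ℝ := (∑ n ∈ Finset.Icc 1 ⌊x⌋₊, b n) / x

theorem abs_sum_Icc_le {b : ℕ → ℝ} (hb : ∀ n, |b n| ≤ 1) (N : ℕ) :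
    |∑ n ∈ Finset.Icc 1 N, b n| ≤ N :=
  (Finset.abs_sum_le_sum_abs _ _).trans
    ((Finset.sum_le_sum fun n _ => hb n).trans (by simp))

theorem abs_meanUpTo_le {b : ℕ → ℝ} (hb : ∀ n, |b n| ≤ 1) {x : ℝ} (hx : 0 ≤ x) :
    |meanUpTo b x| ≤ 1 := by
  rw [meanUpTo, abs_div, abs_of_nonneg hx]
  exact div_le_one_of_le₀ ((abs_sum_Icc_le hb _).trans (Nat.floor_le hx)) hx

theorem abs_meanUpTo_sub_le {b : ℕ → ℝ} (hb : ∀ n, |b n| ≤ 1) {x y : ℝ} (hy : 0 < y)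
    (hyx : y ≤ x) : |meanUpTo b x - meanUpTo b y| ≤ 2 * (1 - y / x) + 1 / x := by
  have hx : 0 < x := hy.trans_le hyx
  have hfl : ⌊y⌋₊ ≤ ⌊x⌋₊ := Nat.floor_le_floor hyx
  have hu : ∑ n ∈ Finset.Icc 1 ⌊x⌋₊, b n =
      ∑ n ∈ Finset.Icc 1 ⌊y⌋₊, b n + ∑ n ∈ Finset.Ioc ⌊y⌋₊ ⌊x⌋₊, b n := by
    rw [← Finset.sum_union]
    · congr 1; ext n; simp only [Finset.mem_union, Finset.mem_Icc, Finset.mem_Ioc]; omega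
    · rw [Finset.disjoint_left]
      intro n h1 h2
      rw [Finset.mem_Icc] at h1; rw [Finset.mem_Ioc] at h2; omega
  have h1 : |∑ n ∈ Finset.Ioc ⌊y⌋₊ ⌊x⌋₊, b n| ≤ x - y + 1 := by
    refine (Finset.abs_sum_le_sum_abs _ _).trans
      ((Finset.sum_le_sum fun n _ => hb n).trans ?_)
    rw [Finset.sum_const, Nat.card_Ioc, nsmul_eq_mul, mul_one, Nat.cast_sub hfl]
    linarith [Nat.floor_le hx.le, Nat.lt_floor_add_one y]
  have h2 : |∑ n ∈ Finset.Icc 1 ⌊y⌋₊, b n| ≤ y :=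
    (abs_sum_Icc_le hb _).trans (Nat.floor_le hy.le)
  set A := ∑ n ∈ Finset.Icc 1 ⌊y⌋₊, b n with hA
  set B := ∑ n ∈ Finset.Ioc ⌊y⌋₊ ⌊x⌋₊, b n with hB
  have h3 : meanUpTo b x - meanUpTo b y = B / x - A * (1 / y - 1 / x) := by
    rw [meanUpTo, meanUpTo, hu]; ring
  have h4 : 0 ≤ 1 / y - 1 / x := sub_nonneg.mpr (one_div_le_one_div_of_le hy hyx)
  rw [h3]
  calc _ ≤ |B / x| + |A * (1 / y - 1 / x)| := abs_sub _ _
    _ ≤ (x - y + 1) / x + y * (1 / y - 1 / x) := by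
      rw [abs_div, abs_mul, abs_of_pos hx, abs_of_nonneg h4]; gcongr
    _ = _ := by field_simp; ring

theorem sum_Icc_ite_dvd {p : ℕ} (hp : 0 < p) (b : ℕ → ℝ) (N : ℕ) :
    ∑ n ∈ Finset.Icc 1 N, (if p ∣ n then b n else 0) = ∑ m ∈ Finset.Icc 1 (N / p), b (p * m) := by
  rw [← Finset.sum_filter]
  symm
  refine Finset.sum_nbij' (fun m => p * m) (fun n => n / p) ?_ ?_ ?_ ?_ ?_
  · intro m hm
    rw [Finset.mem_Icc, Nat.le_div_iff_mul_le hp] at hm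
    rw [Finset.mem_filter, Finset.mem_Icc]
    exact ⟨⟨Nat.mul_pos hp hm.1, by linarith⟩, dvd_mul_right _ _⟩
  · intro n hn
    rw [Finset.mem_filter, Finset.mem_Icc] at hn
    obtain ⟨⟨h1, h2⟩, m, rfl⟩ := hn
    rw [Nat.mul_div_cancel_left _ hp, Finset.mem_Icc, Nat.le_div_iff_mul_le hp]
    exact ⟨Nat.pos_of_mul_pos_left h1, by linarith⟩
  · intro m _; exact Nat.mul_div_cancel_left _ hp
  · intro n hn
    rw [Finset.mem_filter] at hn
    exact Nat.mul_div_cancel' hn.2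
  · intro m _; rfl

theorem sum_Icc_ite_dvd_one {p : ℕ} (hp : 0 < p) (N : ℕ) :
    ∑ n ∈ Finset.Icc 1 N, (if p ∣ n then (1 : ℝ) else 0) = (N / p : ℕ) := by
  rw [sum_Icc_ite_dvd hp (fun _ => 1)]; simp

theorem tendsto_meanUpTo_ite_dvd {d : ℕ} (hd : 0 < d) :
    Filter.Tendsto (meanUpTo fun n => if d ∣ n then 1 else 0) Filter.atTop (nhds (d : ℝ)⁻¹) := by
  have h := tendsto_nat_floor_mul_div_atTop (R := ℝ) (a := (d : ℝ)⁻¹) (by positivity)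
  refine h.congr fun x => ?_
  rw [meanUpTo, sum_Icc_ite_dvd_one hd, ← Nat.floor_div_natCast, inv_mul_eq_div]

/-- Dilating by `p` compares the mean of `b` along multiples of `p` with the mean of `b'`. -/
theorem abs_meanUpTo_dvd_sub_le {b b' : ℕ → ℝ} (hb : ∀ n, |b n| ≤ 1) (hb' : ∀ n, |b' n| ≤ 1)
    {p : ℕ} (hp : 0 < p) (hbb : ∀ m, ¬ p ∣ m → b (p * m) = b' m) {x : ℝ} (hx : 0 < x) :
    |meanUpTo (fun n => if p ∣ n then b n else 0) x - (p : ℝ)⁻¹ * meanUpTo b' (x / p)|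
      ≤ 2 * ((p : ℝ) ^ 2)⁻¹ := by
  have hp0 : (0 : ℝ) < p := by exact_mod_cast hp
  have h1 : (p : ℝ)⁻¹ * meanUpTo b' (x / p) = (∑ m ∈ Finset.Icc 1 (⌊x⌋₊ / p), b' m) / x := by
    rw [meanUpTo, Nat.floor_div_natCast]; field_simp
  rw [h1, meanUpTo, sum_Icc_ite_dvd hp, ← sub_div, ← Finset.sum_sub_distrib, abs_div,
    abs_of_pos hx, div_le_iff₀ hx]
  calc _ ≤ ∑ m ∈ Finset.Icc 1 (⌊x⌋₊ / p), 2 * (if p ∣ m then (1 : ℝ) else 0) := by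
        refine (Finset.abs_sum_le_sum_abs _ _).trans (Finset.sum_le_sum fun m _ => ?_)
        split_ifs with h
        -- Only m divisible by p escape the relation between `b` and `b'`; there are at most x/p² of
        -- them, each costing at most 2.
        · have h2 := abs_sub (b (p * m)) (b' m)
          linarith [hb (p * m), hb' m]
        · rw [hbb m h]; simp
    _ = 2 * ((⌊x⌋₊ / p / p : ℕ) : ℝ) := by rw [← Finset.mul_sum, sum_Icc_ite_dvd_one hp]
    _ ≤ 2 * (x / p / p) := by
        gcongr
        rw [← Nat.floor_div_natCast, ← Nat.floor_div_natCast]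
        exact Nat.floor_le (by positivity)
    _ = _ := by field_simp

theorem meanUpTo_mul_le_sqrt {b h : ℕ → ℝ} (hb : ∀ n, |b n| ≤ 1) {x : ℝ} (hx : 0 < x) :
    meanUpTo (fun n => b n * h n) x ≤ √(meanUpTo (fun n => h n ^ 2) x) := by
  refine Real.le_sqrt_of_sq_le ?_
  rw [meanUpTo, meanUpTo, div_pow, div_le_div_iff₀ (by positivity) hx]
  have h1 := Finset.sum_mul_sq_le_sq_mul_sq (Finset.Icc 1 ⌊x⌋₊) b h
  have h2 : ∑ n ∈ Finset.Icc 1 ⌊x⌋₊, b n ^ 2 ≤ x := by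
    refine (Finset.sum_le_sum fun n _ => (sq_le_one_iff_abs_le_one _).mpr (hb n)).trans ?_
    simpa using Nat.floor_le hx.le
  have h3 : 0 ≤ ∑ n ∈ Finset.Icc 1 ⌊x⌋₊, h n ^ 2 := Finset.sum_nonneg fun _ _ => sq_nonneg _
  calc _ ≤ (x * ∑ n ∈ Finset.Icc 1 ⌊x⌋₊, h n ^ 2) * x := by
        gcongr; exact h1.trans (by gcongr)
    _ = _ := by ring

/-- Divisibility by distinct primes is asymptotically independent, so only the diagonal survives in
the variance below once x → ∞ with the set of primes fixed. -/
theorem tendsto_meanUpTo_prime_correlation {p q : ℕ} (hp : p.Prime) (hq : q.Prime) :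
    Filter.Tendsto (meanUpTo fun n => ((p : ℝ)⁻¹ - if p ∣ n then 1 else 0) *
      ((q : ℝ)⁻¹ - if q ∣ n then 1 else 0)) Filter.atTop
      (nhds (if p = q then (p : ℝ)⁻¹ - ((p : ℝ) ^ 2)⁻¹ else 0)) := by
  have hpp := tendsto_meanUpTo_ite_dvd hp.pos
  have hqq := tendsto_meanUpTo_ite_dvd hq.pos
  have h1 := tendsto_meanUpTo_ite_dvd one_pos
  have hpq : Filter.Tendsto (meanUpTo fun n => (if p ∣ n then 1 else 0) * if q ∣ n then 1 else 0)
      Filter.atTop (nhds (if p = q then (p : ℝ)⁻¹ else (p : ℝ)⁻¹ * (q : ℝ)⁻¹)) := by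
    split_ifs with h
    · subst h
      refine hpp.congr fun x => ?_
      congr 1; ext n; split_ifs <;> simp
    · have hc : Nat.Coprime p q := (Nat.coprime_primes hp hq).mpr h
      have := tendsto_meanUpTo_ite_dvd (Nat.mul_pos hp.pos hq.pos)
      push_cast at this
      rw [mul_inv] at this
      refine this.congr fun x => ?_
      congr 1; ext n
      have : p * q ∣ n ↔ p ∣ n ∧ q ∣ n :=
        ⟨fun h => ⟨(dvd_mul_right _ _).trans h, (dvd_mul_left _ _).trans h⟩,
          fun h => hc.mul_dvd_of_dvd_of_dvd h.1 h.2⟩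
      by_cases h1 : p ∣ n <;> by_cases h2 : q ∣ n <;> simp [this, h1, h2]
  have := (((h1.const_mul ((p : ℝ)⁻¹ * (q : ℝ)⁻¹)).sub (hqq.const_mul (p : ℝ)⁻¹)).sub
    (hpp.const_mul (q : ℝ)⁻¹)).add hpq
  refine (this.congr fun x => ?_).trans (le_of_eq ?_)
  · simp only [meanUpTo, mul_div_assoc', Finset.mul_sum, ← sub_div, ← add_div,
      ← Finset.sum_sub_distrib, ← Finset.sum_add_distrib]
    congr 1
    refine Finset.sum_congr rfl fun n _ => ?_
    rw [if_pos (one_dvd n)]; ring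
  · congr 1
    split_ifs with h
    · subst h; push_cast; field_simp; ring
    · push_cast; ring

/-- The dual Turán–Kubilius inequality for a finite set of primes. -/
theorem sum_mul_meanUpTo_sub_le {b b' : ℕ → ℝ} (hb : ∀ n, |b n| ≤ 1) (hb' : ∀ n, |b' n| ≤ 1)
    {S : Finset ℕ} (hS : ∀ p ∈ S, p.Prime)
    (hbb : ∀ p m, p.Prime → ¬ p ∣ m → b (p * m) = b' m) (c : ℕ → ℝ) {x : ℝ} (hx : 0 < x) :
    ∑ p ∈ S, (p : ℝ)⁻¹ * (c p * (meanUpTo b x - meanUpTo b' (x / p))) ≤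
      √(∑ p ∈ S, ∑ q ∈ S, c p * c q *
        meanUpTo (fun n => ((p : ℝ)⁻¹ - if p ∣ n then 1 else 0) *
          ((q : ℝ)⁻¹ - if q ∣ n then 1 else 0)) x) +
      ∑ p ∈ S, 2 * |c p| * ((p : ℝ) ^ 2)⁻¹ := by
  -- The left side is the correlation of `b` with `h`, up to the dilation errors; Cauchy–Schwarz
  -- then leaves the second moment of `h`, whose expansion is the double sum.
  set h : ℕ → ℝ := fun n => ∑ p ∈ S, c p * ((p : ℝ)⁻¹ - if p ∣ n then 1 else 0) with hh
  have h1 : meanUpTo (fun n => h n ^ 2) x = ∑ p ∈ S, ∑ q ∈ S, c p * c q *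
        meanUpTo (fun n => ((p : ℝ)⁻¹ - if p ∣ n then 1 else 0) *
          ((q : ℝ)⁻¹ - if q ∣ n then 1 else 0)) x := by
    simp only [meanUpTo, mul_div_assoc', ← Finset.sum_div]
    congr 1
    simp only [Finset.mul_sum]
    have : ∀ p ∈ S, ∑ q ∈ S, ∑ n ∈ Finset.Icc 1 ⌊x⌋₊, c p * c q *
        (((p : ℝ)⁻¹ - if p ∣ n then 1 else 0) * ((q : ℝ)⁻¹ - if q ∣ n then 1 else 0)) =
        ∑ n ∈ Finset.Icc 1 ⌊x⌋₊, ∑ q ∈ S, c p * c q *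
        (((p : ℝ)⁻¹ - if p ∣ n then 1 else 0) * ((q : ℝ)⁻¹ - if q ∣ n then 1 else 0)) :=
      fun p _ => Finset.sum_comm
    rw [Finset.sum_congr rfl this, Finset.sum_comm]
    refine Finset.sum_congr rfl fun n _ => ?_
    rw [hh, sq, Finset.sum_mul_sum]
    exact Finset.sum_congr rfl fun p _ => Finset.sum_congr rfl fun q _ => by ring
  have h2 : ∑ p ∈ S, (p : ℝ)⁻¹ * (c p * (meanUpTo b x - meanUpTo b' (x / p))) =
      meanUpTo (fun n => b n * h n) x + ∑ p ∈ S, c p *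
        (meanUpTo (fun n => if p ∣ n then b n else 0) x - (p : ℝ)⁻¹ * meanUpTo b' (x / p)) := by
    have h3 : meanUpTo (fun n => b n * h n) x = ∑ p ∈ S, c p * ((p : ℝ)⁻¹ * meanUpTo b x -
        meanUpTo (fun n => if p ∣ n then b n else 0) x) := by
      simp only [meanUpTo, mul_div_assoc', ← sub_div, ← Finset.sum_div]
      congr 1
      simp only [hh, Finset.mul_sum, ← Finset.sum_sub_distrib]
      rw [Finset.sum_comm]
      refine Finset.sum_congr rfl fun p _ => Finset.sum_congr rfl fun n _ => ?_
      split_ifs <;> ring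
    rw [h3, ← Finset.sum_add_distrib]
    exact Finset.sum_congr rfl fun p _ => by ring
  rw [h2, ← h1]
  refine add_le_add (meanUpTo_mul_le_sqrt hb hx) (Finset.sum_le_sum fun p hp => ?_)
  refine (le_abs_self _).trans ?_
  rw [abs_mul]
  have := abs_meanUpTo_dvd_sub_le hb hb' (hS p hp).pos (hbb p · (hS p hp)) hx
  calc _ ≤ |c p| * (2 * ((p : ℝ) ^ 2)⁻¹) := by gcongr
    _ = _ := by ring

/-! ### Limit functions of the means along an ultrafilter. -/

theorem exists_ultrafilter_limit (U : Ultrafilter ℕ) {u : ℕ → ℝ} (hu : ∀ n, |u n| ≤ 1) :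
    ∃ l, |l| ≤ 1 ∧ Filter.Tendsto u U (nhds l) := by
  obtain ⟨l, hl, h⟩ := (isCompact_Icc (a := (-1 : ℝ)) (b := 1)).ultrafilter_le_nhds (U.map u)
    (Filter.le_principal_iff.mpr
      (Filter.mem_map.mpr (Filter.Eventually.of_forall fun n => abs_le.mp (hu n))))
  exact ⟨l, abs_le.mpr hl, h⟩

theorem le_of_le_sqrt_add {Q Z : ℝ} (hQ : 0 ≤ Q) (h : Q ≤ √Q + Z) : Q ≤ 1 + 2 * Z := by
  nlinarith [Real.sq_sqrt hQ, sq_nonneg (√Q - 1)]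

section Limit

variable {b b' : ℕ → ℝ} {U : Ultrafilter ℕ} {G G' : ℝ → ℝ}

theorem tendsto_natCast_mul_exp (s : ℝ) :
    Filter.Tendsto (fun N : ℕ => (N : ℝ) * Real.exp s) Filter.atTop Filter.atTop :=
  tendsto_natCast_atTop_atTop.atTop_mul_const (Real.exp_pos s)

theorem limit_lipschitz (hb : ∀ n, |b n| ≤ 1) (hU : (U : Filter ℕ) ≤ Filter.atTop)
    (hG : ∀ s, Filter.Tendsto (fun N : ℕ => meanUpTo b (N * Real.exp s)) U (nhds (G s)))
    (s t : ℝ) : |G s - G t| ≤ 2 * |s - t| := by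
  wlog hst : t ≤ s generalizing s t
  · rw [abs_sub_comm, abs_sub_comm s]; exact this t s (by linarith)
  rw [abs_of_nonneg (sub_nonneg.mpr hst)]
  have h1 : Filter.Tendsto (fun N : ℕ => 2 * (1 - Real.exp (t - s)) + 1 / (N * Real.exp s)) U
      (nhds (2 * (1 - Real.exp (t - s)) + 0)) := by
    refine Filter.Tendsto.const_add _ ?_
    simp only [one_div]
    exact (tendsto_inv_atTop_zero.comp (tendsto_natCast_mul_exp s)).mono_left hU
  have h2 := le_of_tendsto_of_tendsto ((hG s).sub (hG t)).abs h1 <| by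
    filter_upwards [hU (Filter.eventually_ge_atTop 1)] with N hN
    have hN0 : (0 : ℝ) < N := by exact_mod_cast hN
    have h3 := abs_meanUpTo_sub_le hb (x := N * Real.exp s) (y := N * Real.exp t)
      (by positivity) (by gcongr)
    rwa [mul_div_mul_left _ _ hN0.ne', ← Real.exp_sub] at h3
  have h4 := Real.add_one_le_exp (t - s)
  linarith

/-- Duality: taking the differences themselves as coefficients turns the limiting inequality into Q
≤ √Q + Z for the sum Q in question, with Z independent of `S`, which bounds Q. Here |c p| ≤ 2 gives
Z ≤ 4 ∑ n⁻². -/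
theorem limit_sum_sq_le (hb : ∀ n, |b n| ≤ 1) (hb' : ∀ n, |b' n| ≤ 1)
    (hbb : ∀ p m, p.Prime → ¬ p ∣ m → b (p * m) = b' m) (hU : (U : Filter ℕ) ≤ Filter.atTop)
    (hG : ∀ s, Filter.Tendsto (fun N : ℕ => meanUpTo b (N * Real.exp s)) U (nhds (G s)))
    (hG' : ∀ s, Filter.Tendsto (fun N : ℕ => meanUpTo b' (N * Real.exp s)) U (nhds (G' s)))
    (hG1 : ∀ s, |G s| ≤ 1) (hG1' : ∀ s, |G' s| ≤ 1) (s : ℝ) (S : Finset ℕ)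
    (hS : ∀ p ∈ S, p.Prime) :
    ∑ p ∈ S, (p : ℝ)⁻¹ * (G s - G' (s - Real.log p)) ^ 2 ≤
      1 + 2 * (4 * ∑' n : ℕ, ((n : ℝ) ^ 2)⁻¹) := by
  set c : ℕ → ℝ := fun p => G s - G' (s - Real.log p) with hc
  have hc2 : ∀ p, |c p| ≤ 2 := fun p => by
    have := abs_sub (G s) (G' (s - Real.log p))
    have h1 := hG1 s
    have h2 := hG1' (s - Real.log p)
    simp only [hc]; linarith
  have hten := tendsto_natCast_mul_exp s
  have hlhs : Filter.Tendsto (fun N : ℕ => ∑ p ∈ S, (p : ℝ)⁻¹ * (c p *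
      (meanUpTo b (N * Real.exp s) - meanUpTo b' (N * Real.exp s / p)))) U
      (nhds (∑ p ∈ S, (p : ℝ)⁻¹ * (c p * (G s - G' (s - Real.log p))))) := by
    refine tendsto_finsetSum _ fun p hp => ((((hG s).sub ?_).const_mul _).const_mul _)
    refine (hG' (s - Real.log p)).congr fun N => ?_
    rw [Real.exp_sub, Real.exp_log (by exact_mod_cast (hS p hp).pos), mul_div_assoc]
  have hrhs : Filter.Tendsto (fun N : ℕ => √(∑ p ∈ S, ∑ q ∈ S, c p * c q *
        meanUpTo (fun n => ((p : ℝ)⁻¹ - if p ∣ n then 1 else 0) *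
          ((q : ℝ)⁻¹ - if q ∣ n then 1 else 0)) (N * Real.exp s)) +
      ∑ p ∈ S, 2 * |c p| * ((p : ℝ) ^ 2)⁻¹) U
      (nhds (√(∑ p ∈ S, ∑ q ∈ S, c p * c q *
        (if p = q then (p : ℝ)⁻¹ - ((p : ℝ) ^ 2)⁻¹ else 0)) +
      ∑ p ∈ S, 2 * |c p| * ((p : ℝ) ^ 2)⁻¹)) := by
    refine Filter.Tendsto.add_const _ (Filter.Tendsto.sqrt ?_)
    exact tendsto_finsetSum _ fun p hp => tendsto_finsetSum _ fun q hq =>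
      (((tendsto_meanUpTo_prime_correlation (hS p hp) (hS q hq)).comp hten).mono_left hU).const_mul _
  have h1 := le_of_tendsto_of_tendsto hlhs hrhs <| by
    filter_upwards [hU (Filter.eventually_ge_atTop 1)] with N hN
    have hN0 : (0 : ℝ) < N := by exact_mod_cast hN
    exact sum_mul_meanUpTo_sub_le hb hb' hS hbb c (by positivity)
  refine le_of_le_sqrt_add (Finset.sum_nonneg fun p _ => by positivity) ?_
  calc _ = ∑ p ∈ S, (p : ℝ)⁻¹ * (c p * (G s - G' (s - Real.log p))) :=
        Finset.sum_congr rfl fun p _ => by rw [hc, sq]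
    _ ≤ _ := h1
    _ ≤ _ := by
      gcongr with p hp
      · rw [Finset.sum_eq_single p]
        · rw [if_pos rfl]
          have : 0 ≤ ((p : ℝ) ^ 2)⁻¹ := by positivity
          have h2 := mul_nonneg (sq_nonneg (c p)) this
          have h3 : c p ^ 2 = (G s - G' (s - Real.log p)) ^ 2 := rfl
          rw [← h3]; nlinarith
        · intro q _ hq; rw [if_neg (Ne.symm hq)]; simp
        · intro h; exact absurd hp h
      · have hsum : Summable fun n : ℕ => ((n : ℝ) ^ 2)⁻¹ :=
          Real.summable_nat_pow_inv.mpr one_lt_two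
        refine le_trans ?_ (mul_le_mul_of_nonneg_left
          (hsum.sum_le_tsum S fun n _ => by positivity) (by norm_num : (0 : ℝ) ≤ 4))
        rw [Finset.mul_sum]
        gcongr with p hp
        linarith [hc2 p]

end Limit

/-! ### Asymptotic invariance under shifting the number of prime factors. -/

/-- The mean of `a ∘ Ω` over squarefree numbers is asymptotically invariant under shifting `a`. -/
theorem tendsto_meanUpTo_squarefree_shift {a : ℕ → ℝ} (ha : ∀ n, |a n| ≤ 1) :
    Filter.Tendsto (fun N : ℕ =>
      meanUpTo (fun n => if Squarefree n then a (ArithmeticFunction.cardFactors n) else 0) N -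
      meanUpTo (fun n => if Squarefree n then a (ArithmeticFunction.cardFactors n + 1) else 0) N)
      Filter.atTop (nhds 0) := by
  set b : ℕ → ℕ → ℝ := fun j n =>
    if Squarefree n then a (ArithmeticFunction.cardFactors n + j) else 0 with hb_def
  have hb : ∀ j n, |b j n| ≤ 1 := fun j n => by
    simp only [hb_def]; split_ifs
    · exact ha _
    · simp
  have hbb : ∀ j p m, p.Prime → ¬ p ∣ m → b j (p * m) = b (j + 1) m := by
    intro j p m hp hpm
    have hc : Nat.Coprime p m := (Nat.Prime.coprime_iff_not_dvd hp).mpr hpm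
    have hm : m ≠ 0 := by rintro rfl; simp at hpm
    have h1 : Squarefree (p * m) ↔ Squarefree m := by
      rw [Nat.squarefree_mul_iff]
      exact ⟨fun h => h.2.2, fun h => ⟨hc, hp.prime.squarefree, h⟩⟩
    simp only [hb_def, h1]
    rw [ArithmeticFunction.cardFactors_mul hp.ne_zero hm,
      ArithmeticFunction.cardFactors_apply_prime hp]
    congr 2; ring
  -- Along an ultrafilter the means converge at all scales `s` and all shifts `j` at once, with no
  -- subsequences to extract.
  rw [Filter.tendsto_iff_ultrafilter]
  intro U hU
  have hlim : ∀ j s, ∃ l, |l| ≤ 1 ∧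
      Filter.Tendsto (fun N : ℕ => meanUpTo (b j) (N * Real.exp s)) U (nhds l) := fun j s =>
    exists_ultrafilter_limit U fun N => abs_meanUpTo_le (hb j) (by positivity)
  choose G hG1 hG using hlim
  have hsq := fun j => limit_sum_sq_le (hb j) (hb (j + 1)) (hbb j) hU (hG j) (hG (j + 1)) (hG1 j)
    (hG1 (j + 1))
  -- Three consecutive shifts are used: comparison with `G 2` makes `G 1` constant, and then `G 0`
  -- at 0 must equal that constant.
  have hconst : ∀ s t, G 1 s = G 1 t := eq_of_prime_shift (by norm_num)
    (limit_lipschitz (hb 1) hU (hG 1)) (limit_lipschitz (hb 2) hU (hG 2)) (hsq 1)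
  have h0 : G 0 0 = G 1 0 := eq_of_prime_shift_of_const hconst (hsq 0)
  have := (hG 0 0).sub (hG 1 0)
  rw [h0, sub_self] at this
  simpa only [Real.exp_zero, mul_one, hb_def, add_zero] using this

/-! ### The density of the squarefree numbers. -/

section SquarefreeDensity

theorem sq_dvd_sq_mul_iff {a b d : ℕ} (ha : Squarefree a) (hb : 0 < b) :
    d ^ 2 ∣ b ^ 2 * a ↔ d ∣ b := by
  refine ⟨fun h => ?_, fun h => (pow_dvd_pow_of_dvd h 2).trans (dvd_mul_right _ _)⟩
  obtain ⟨g, d', b', hg, hc, rfl, rfl⟩ := Nat.exists_coprime' (m := d) (n := b)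
    (Nat.gcd_pos_of_pos_right _ hb)
  rw [mul_pow, mul_pow, mul_right_comm, Nat.mul_dvd_mul_iff_right (by positivity)] at h
  have h1 : d' * d' ∣ a := by
    rw [← sq]
    exact (Nat.Coprime.pow 2 2 hc).dvd_of_dvd_mul_left h
  have h2 := Nat.isUnit_iff.mp (ha d' h1)
  rw [h2, one_mul]
  exact dvd_mul_left _ _

/-- Writing n = b²a with a squarefree, d² ∣ n means d ∣ b, so the sum is ∑ μ(d) over d ∣ b, which
detects b = 1. -/
theorem sum_moebius_sq_dvd {n N : ℕ} (hn : 0 < n) (hN : n ≤ N) :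
    ∑ d ∈ Finset.Icc 1 N, (if d ^ 2 ∣ n then ((ArithmeticFunction.moebius d : ℤ) : ℝ) else 0) =
      if Squarefree n then 1 else 0 := by
  obtain ⟨a, b, ha, hb, rfl, hsq⟩ := Nat.sq_mul_squarefree_of_pos hn
  simp only [sq_dvd_sq_mul_iff hsq hb]
  have h1 : ∑ d ∈ Finset.Icc 1 N, (if d ∣ b then ((ArithmeticFunction.moebius d : ℤ) : ℝ) else 0) =
      ∑ d ∈ b.divisors, ((ArithmeticFunction.moebius d : ℤ) : ℝ) := by
    rw [← Finset.sum_filter]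
    refine Finset.sum_congr ?_ fun _ _ => rfl
    ext d
    rw [Finset.mem_filter, Finset.mem_Icc, Nat.mem_divisors]
    refine ⟨fun h => ⟨h.2, hb.ne'⟩, fun h => ⟨⟨Nat.pos_of_dvd_of_pos h.1 hb, ?_⟩, h.1⟩⟩
    have h3 := Nat.le_of_dvd hb h.1
    nlinarith
  rw [h1, ← Nat.sum_divisorsAntidiagonal (fun d _ => ((ArithmeticFunction.moebius d : ℤ) : ℝ)),
    sum_divisorsAntidiagonal_moebius]
  congr 1
  rw [eq_iff_iff]
  constructor
  · rintro rfl; simpa using hsq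
  · intro h
    exact Nat.isUnit_iff.mp (h b ⟨a, by ring⟩)

theorem tsum_moebius_div_sq :
    ∑' d : ℕ, ((ArithmeticFunction.moebius d : ℤ) : ℝ) * ((d : ℝ) ^ 2)⁻¹ = 6 / Real.pi ^ 2 := by
  have h1 := ArithmeticFunction.LSeries_zeta_mul_Lseries_moebius (s := 2) (by norm_num)
  rw [ArithmeticFunction.LSeries_zeta_eq_riemannZeta (by norm_num), riemannZeta_two] at h1
  have h2 : LSeries (fun n => ((ArithmeticFunction.moebius n : ℤ) : ℂ)) 2 =
      ((∑' d : ℕ, ((ArithmeticFunction.moebius d : ℤ) : ℝ) * ((d : ℝ) ^ 2)⁻¹ : ℝ) : ℂ) := by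
    rw [LSeries, Complex.ofReal_tsum]
    refine tsum_congr fun n => ?_
    rcases eq_or_ne n 0 with rfl | hn
    · simp
    · rw [LSeries.term_of_ne_zero hn]
      push_cast
      rw [div_eq_mul_inv]
      norm_cast
  rw [h2] at h1
  have h3 : Real.pi ^ 2 / 6 *
      ∑' d : ℕ, ((ArithmeticFunction.moebius d : ℤ) : ℝ) * ((d : ℝ) ^ 2)⁻¹ = 1 := by
    exact_mod_cast h1
  have hpi := Real.pi_pos
  field_simp at h3 ⊢
  linarith

/-- The squarefree numbers have density `6 / π ^ 2`. -/
theorem tendsto_meanUpTo_squarefree :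
    Filter.Tendsto (fun N : ℕ => meanUpTo (fun n => if Squarefree n then 1 else 0) N)
      Filter.atTop (nhds (6 / Real.pi ^ 2)) := by
  rw [← tsum_moebius_div_sq]
  have hterm : ∀ N : ℕ, meanUpTo (fun n => if Squarefree n then 1 else 0) N =
      ∑' d : ℕ, ((ArithmeticFunction.moebius d : ℤ) : ℝ) * (((N / d ^ 2 : ℕ) : ℝ) / N) := by
    intro N
    rw [tsum_eq_sum (s := Finset.Icc 1 N), meanUpTo, Nat.floor_natCast]
    · rw [Finset.sum_congr rfl fun n hn => (sum_moebius_sq_dvd (Finset.mem_Icc.mp hn).1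
        (Finset.mem_Icc.mp hn).2).symm, Finset.sum_comm, Finset.sum_div]
      refine Finset.sum_congr rfl fun d hd => ?_
      have hd0 : 0 < d ^ 2 := pow_pos (Finset.mem_Icc.mp hd).1 2
      rw [sum_Icc_ite_dvd hd0 (fun _ => ((ArithmeticFunction.moebius d : ℤ) : ℝ))]
      simp; ring
    · intro d hd
      rw [Finset.mem_Icc, not_and_or, not_le, not_le] at hd
      rcases hd with hd | hd
      · have : d = 0 := by omega
        simp [this]
      · rw [Nat.div_eq_of_lt (by nlinarith)]; simp
  simp only [hterm]
  -- For each d the proportion of multiples of d² tends to d⁻² and never exceeds it, so the limit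
  -- passes inside the series.
  refine tendsto_tsum_of_dominated_convergence (bound := fun d : ℕ => ((d : ℝ) ^ 2)⁻¹)
    (Real.summable_nat_pow_inv.mpr one_lt_two) (fun d => ?_) (Filter.Eventually.of_forall fun N d => ?_)
  · refine Filter.Tendsto.const_mul _ ?_
    rcases Nat.eq_zero_or_pos d with rfl | hd
    · simp
    have h := (tendsto_meanUpTo_ite_dvd (pow_pos hd 2)).comp
      (tendsto_natCast_atTop_atTop (R := ℝ))
    push_cast at h
    refine h.congr fun N => ?_
    rw [Function.comp, meanUpTo, sum_Icc_ite_dvd_one (pow_pos hd 2), Nat.floor_natCast]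
  · rw [norm_mul, Real.norm_eq_abs, Real.norm_of_nonneg (by positivity)]
    have h1 : ((N / d ^ 2 : ℕ) : ℝ) / N ≤ ((d : ℝ) ^ 2)⁻¹ := by
      refine div_le_of_le_mul₀ (by positivity) (by positivity) ?_
      refine Nat.cast_div_le.trans (le_of_eq ?_)
      push_cast; ring
    calc _ ≤ 1 * ((d : ℝ) ^ 2)⁻¹ :=
          mul_le_mul (abs_moebius_cast_le_one d) h1 (by positivity) zero_le_one
      _ = _ := one_mul _

end SquarefreeDensity

/-! ### Iterated shifts and their averages. -/

theorem tendsto_meanUpTo_squarefree_shift_add {a : ℕ → ℝ} {M : ℝ} (hM : 0 < M)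
    (ha : ∀ n, |a n| ≤ M) (j : ℕ) :
    Filter.Tendsto (fun N : ℕ =>
      meanUpTo (fun n => if Squarefree n then a (ArithmeticFunction.cardFactors n) else 0) N -
      meanUpTo (fun n => if Squarefree n then a (ArithmeticFunction.cardFactors n + j) else 0) N)
      Filter.atTop (nhds 0) := by
  induction j with
  | zero => simp
  | succ j ih =>
    have h1 := (tendsto_meanUpTo_squarefree_shift (a := fun n => a (n + j) / M) (fun n => by
      rw [abs_div, abs_of_pos hM]; exact div_le_one_of_le₀ (ha _) hM.le)).const_mul M
    rw [mul_zero] at h1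
    have h2 := ih.add h1
    rw [add_zero] at h2
    refine h2.congr fun N => ?_
    have h3 : ∀ u : ℕ → ℝ, M * meanUpTo (fun n => if Squarefree n then u n / M else 0) N =
        meanUpTo (fun n => if Squarefree n then u n else 0) N := fun u => by
      rw [meanUpTo, meanUpTo, mul_div_assoc', Finset.mul_sum]
      congr 1
      refine Finset.sum_congr rfl fun n _ => ?_
      split_ifs
      · field_simp
      · simp
    rw [mul_sub, h3, h3]
    simp only [show ∀ m, m + (j + 1) = m + 1 + j by intro m; ring]
    ring

theorem average_meanUpTo_squarefree_sub (a : ℕ → ℝ) (I x : ℝ) (H : ℕ) :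
    (∑ j ∈ Finset.range (H + 1), meanUpTo (fun n =>
      if Squarefree n then a (ArithmeticFunction.cardFactors n + j) else 0) x) / ((H + 1 : ℕ) : ℝ) -
      I * meanUpTo (fun n => if Squarefree n then 1 else 0) x =
    meanUpTo (fun n => if Squarefree n then
      (∑ j ∈ Finset.range (H + 1), a (ArithmeticFunction.cardFactors n + j)) /
        ((H + 1 : ℕ) : ℝ) - I else 0) x := by
  simp only [meanUpTo, ← Finset.sum_div]
  rw [div_right_comm, mul_div_assoc', ← sub_div]
  congr 1
  rw [Finset.sum_comm, Finset.mul_sum, Finset.sum_div, ← Finset.sum_sub_distrib]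
  refine Finset.sum_congr rfl fun n _ => ?_
  split_ifs
  · rw [mul_one]
  · simp

/-! ### Uniform averages under unique ergodicity, and the conclusion. -/

section UniqueErgodicity

/-- The uniform measure on the first `n + 1` points of the `T`-orbit of `y`. -/
noncomputable def empiricalMeasure {X : Type*} [MeasurableSpace X] (T : X → X) (y : X) (n : ℕ) :
    Measure X :=
  ((n + 1 : ℕ) : ENNReal)⁻¹ • ∑ j ∈ Finset.range (n + 1), Measure.dirac (T^[j] y)

theorem isProbabilityMeasure_empiricalMeasure {X : Type*} [MeasurableSpace X] (T : X → X) (y : X)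
    (n : ℕ) : IsProbabilityMeasure (empiricalMeasure T y n) := by
  constructor
  rw [empiricalMeasure, Measure.smul_apply, Measure.finsetSum_apply]
  simp only [measure_univ, Finset.sum_const, Finset.card_range, smul_eq_mul, nsmul_eq_mul, mul_one]
  exact ENNReal.inv_mul_cancel (by simp) (ENNReal.natCast_ne_top _)

variable {X : Type*} [MetricSpace X] [CompactSpace X] [MeasurableSpace X] [BorelSpace X]

theorem integral_empiricalMeasure (T : X → X) (y : X) (n : ℕ) {g : X → ℝ} (hg : Continuous g) :
    ∫ z, g z ∂(empiricalMeasure T y n) =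
      (∑ j ∈ Finset.range (n + 1), g (T^[j] y)) / ((n + 1 : ℕ) : ℝ) := by
  rw [empiricalMeasure, integral_smul_measure, integral_finsetSum_measure]
  · simp only [integral_dirac' _ _ hg.stronglyMeasurable]
    rw [ENNReal.toReal_inv, ENNReal.toReal_natCast, smul_eq_mul, inv_mul_eq_div]
  · intro j _
    exact hg.integrable_of_hasCompactSupport (HasCompactSupport.of_compactSpace g)

/-- Birkhoff averages of a continuous function converge uniformly for a uniquely ergodic map. -/
theorem exists_uniform_average {T : X → X} (hT : Continuous T) {μ : Measure X}
    (hμ : IsUniquelyErgodic T μ) {g : X → ℝ} (hg : Continuous g) {ε : ℝ} (hε : 0 < ε) :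
    ∃ n : ℕ, ∀ y, |(∑ j ∈ Finset.range (n + 1), g (T^[j] y)) / ((n + 1 : ℕ) : ℝ) -
      ∫ z, g z ∂μ| ≤ ε := by
  -- Krylov–Bogoliubov: if every length n has a bad starting point `y n`, a limit of the empirical
  -- measures along these orbits is T-invariant, hence μ, and the averages of `g` at `y n` do
  -- approach ∫ g dμ.
  by_contra! hcon
  choose y hy using hcon
  let ν : ℕ → ProbabilityMeasure X := fun n =>
    ⟨empiricalMeasure T (y n) n, isProbabilityMeasure_empiricalMeasure T (y n) n⟩
  let U : Ultrafilter ℕ := Filter.hyperfilter ℕ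
  have hU : (U : Filter ℕ) ≤ Filter.atTop := Nat.hyperfilter_le_atTop
  obtain ⟨l, -, hl⟩ := (isCompact_univ (X := ProbabilityMeasure X)).ultrafilter_le_nhds (U.map ν)
    (by simp)
  have hlim : ∀ h : X → ℝ, Continuous h → Filter.Tendsto (fun n =>
      (∑ j ∈ Finset.range (n + 1), h (T^[j] (y n))) / ((n + 1 : ℕ) : ℝ)) U
      (nhds (∫ z, h z ∂(l : Measure X))) := by
    intro h hh
    have h1 := (ProbabilityMeasure.tendsto_iff_forall_integral_tendsto.mp
      (show Filter.Tendsto ν U (nhds l) from hl)) (BoundedContinuousFunction.mkOfCompact ⟨h, hh⟩)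
    refine h1.congr fun n => ?_
    exact integral_empiricalMeasure T (y n) n hh
  have hinv : MeasurePreserving T (l : Measure X) (l : Measure X) := by
    refine ⟨hT.measurable, ?_⟩
    have : IsProbabilityMeasure (Measure.map T (l : Measure X)) :=
      Measure.isProbabilityMeasure_map hT.measurable.aemeasurable
    refine ext_of_forall_integral_eq_of_IsFiniteMeasure fun h => ?_
    rw [integral_map hT.measurable.aemeasurable h.continuous.aestronglyMeasurable]
    have h1 := (hlim (fun z => h (T z)) (h.continuous.comp hT)).sub (hlim h h.continuous)
    refine sub_eq_zero.mp (tendsto_nhds_unique h1 ?_)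
    have h2 : Filter.Tendsto (fun n : ℕ => 2 * ‖h‖ / ((n + 1 : ℕ) : ℝ)) U (nhds 0) :=
      ((tendsto_const_div_atTop_nhds_zero_nat (2 * ‖h‖)).comp
        (Filter.tendsto_add_atTop_nat 1)).mono_left hU
    refine squeeze_zero_norm (fun n => ?_) h2
    -- The two orbit sums telescope to their endpoints, so their averages differ by O(1/n).
    have h3 : ∑ j ∈ Finset.range (n + 1), h (T (T^[j] (y n))) -
        ∑ j ∈ Finset.range (n + 1), h (T^[j] (y n)) = h (T^[n + 1] (y n)) - h (y n) := by
      rw [← Finset.sum_sub_distrib]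
      simpa only [Function.iterate_succ_apply', Function.iterate_zero_apply] using
        Finset.sum_range_sub (fun j => h (T^[j] (y n))) (n + 1)
    rw [← sub_div, h3, norm_div, Real.norm_natCast]
    gcongr
    have h4 := norm_sub_le (h (T^[n + 1] (y n))) (h (y n))
    linarith [h.norm_coe_le_norm (T^[n + 1] (y n)), h.norm_coe_le_norm (y n)]
  have hlμ : (l : Measure X) = μ := hμ.unique _ inferInstance hinv
  have h1 := hlim g hg
  rw [hlμ] at h1
  obtain ⟨n, hn⟩ := (h1.eventually (Metric.closedBall_mem_nhds _ hε)).exists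
  rw [Real.dist_eq] at hn
  exact absurd hn (not_le.mpr (hy n))

theorem tendsto_meanUpTo_squarefree_orbit {T : X → X} (hT : Continuous T) {μ : Measure X}
    (hμ : IsUniquelyErgodic T μ) (x : X) {g : X → ℝ} (hg : Continuous g) :
    Filter.Tendsto (fun N : ℕ => meanUpTo (fun n =>
      if Squarefree n then g (T^[ArithmeticFunction.cardFactors n] x) else 0) N)
      Filter.atTop (nhds (6 / Real.pi ^ 2 * ∫ z, g z ∂μ)) := by
  set I := ∫ z, g z ∂μ with hI
  set a : ℕ → ℝ := fun k => g (T^[k] x) with ha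
  set B : ℕ → ℕ → ℝ := fun j N => meanUpTo (fun n =>
    if Squarefree n then a (ArithmeticFunction.cardFactors n + j) else 0) N with hB
  set Q : ℕ → ℝ := fun N => meanUpTo (fun n => if Squarefree n then 1 else 0) N with hQ
  obtain ⟨M, hM0, hM⟩ : ∃ M, 0 < M ∧ ∀ z, |g z| ≤ M := by
    refine ⟨‖BoundedContinuousFunction.mkOfCompact ⟨g, hg⟩‖ + 1, by positivity, fun z => ?_⟩
    have := (BoundedContinuousFunction.mkOfCompact ⟨g, hg⟩).norm_coe_le_norm z
    rw [Real.norm_eq_abs] at this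
    exact this.trans (by linarith)
  have hshift : ∀ j, Filter.Tendsto (fun N => B 0 N - B j N) Filter.atTop (nhds 0) := fun j => by
    have haM : ∀ n, |a n| ≤ M := fun n => hM _
    simpa only [hB, add_zero] using tendsto_meanUpTo_squarefree_shift_add hM0 haM j
  suffices h : Filter.Tendsto (fun N => B 0 N - I * Q N) Filter.atTop (nhds 0) by
    have h1 := h.add (tendsto_meanUpTo_squarefree.const_mul I)
    rw [zero_add, mul_comm] at h1
    refine h1.congr fun N => ?_
    rw [sub_add_cancel]
    rfl
  rw [Metric.tendsto_atTop]
  intro ε hε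
  obtain ⟨H, hH⟩ := exists_uniform_average hT hμ hg (show 0 < ε / 3 by positivity)
  have hH0 : (0 : ℝ) < ((H + 1 : ℕ) : ℝ) := by positivity
  have h1 : Filter.Tendsto (fun N => (∑ j ∈ Finset.range (H + 1), (B 0 N - B j N)) /
      ((H + 1 : ℕ) : ℝ)) Filter.atTop (nhds 0) := by
    have := (tendsto_finsetSum (Finset.range (H + 1)) fun j _ => hshift j).div_const
      ((H + 1 : ℕ) : ℝ)
    simpa using this
  obtain ⟨N₀, hN₀⟩ := Metric.tendsto_atTop.mp h1 (ε / 3) (by positivity)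
  refine ⟨N₀, fun N hN => ?_⟩
  have h2 := hN₀ N hN
  rw [Real.dist_0_eq_abs] at h2 ⊢
  -- With `H` fixed, the first term vanishes as N → ∞ by shift invariance. The second is at most ε/3
  -- for every N, since the orbit average of length `H + 1` started at T^Ω(n) x is uniformly close
  -- to `I`.
  have h3 : B 0 N - I * Q N = (∑ j ∈ Finset.range (H + 1), (B 0 N - B j N)) / ((H + 1 : ℕ) : ℝ) +
      ((∑ j ∈ Finset.range (H + 1), B j N) / ((H + 1 : ℕ) : ℝ) - I * Q N) := by
    rw [Finset.sum_sub_distrib, Finset.sum_const, Finset.card_range, nsmul_eq_mul]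
    field_simp; ring
  have h5 : |(∑ j ∈ Finset.range (H + 1), B j N) / ((H + 1 : ℕ) : ℝ) - I * Q N| ≤ ε / 3 := by
    rw [hB, hQ, average_meanUpTo_squarefree_sub, meanUpTo, abs_div, abs_of_nonneg (Nat.cast_nonneg (α := ℝ) N)]
    refine div_le_of_le_mul₀ (Nat.cast_nonneg _) (by positivity) ?_
    refine (Finset.abs_sum_le_sum_abs _ _).trans ?_
    calc _ ≤ ∑ n ∈ Finset.Icc 1 ⌊(N : ℝ)⌋₊, ε / 3 := by
          refine Finset.sum_le_sum fun n _ => ?_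
          split_ifs
          · have h4 := hH (T^[ArithmeticFunction.cardFactors n] x)
            simp only [← Function.iterate_add_apply] at h4
            simpa only [ha, add_comm] using h4
          · simp; positivity
      _ = _ := by simp; ring
  rw [h3]
  refine (abs_add_le _ _).trans_lt ?_
  linarith

end UniqueErgodicity

theorem mainTheorem9 {X : Type*} [MetricSpace X] [CompactSpace X] [MeasurableSpace X]
    [BorelSpace X] (T : X → X) (hT : Continuous T) (μ : Measure X)
    (hμ : IsUniquelyErgodic T μ) (x : X) (f : C(X, ℂ)) :
    Filter.Tendsto
      (fun N : ℕ => (1 / (N : ℂ)) *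
        ∑ n ∈ (Finset.Icc 1 N).filter (fun n => Squarefree n),
          f (T^[ArithmeticFunction.cardFactors n] x))
      Filter.atTop (nhds ((6 / (Real.pi : ℂ) ^ 2) * ∫ y, f y ∂μ)) := by
  have := hμ.isProbabilityMeasure
  have hre : Continuous fun y => (f y).re := Complex.continuous_re.comp f.continuous
  have him : Continuous fun y => (f y).im := Complex.continuous_im.comp f.continuous
  have h1 := tendsto_meanUpTo_squarefree_orbit hT hμ x hre
  have h2 := tendsto_meanUpTo_squarefree_orbit hT hμ x him
  have hint : Integrable f μ :=
    f.continuous.integrable_of_hasCompactSupport (HasCompactSupport.of_compactSpace f)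
  have h3 : ∫ y, f y ∂μ = ((∫ y, (f y).re ∂μ : ℝ) : ℂ) + ((∫ y, (f y).im ∂μ : ℝ) : ℂ) * Complex.I :=
    (integral_re_add_im hint).symm
  have h4 := ((Complex.continuous_ofReal.tendsto _).comp h1).add
    (((Complex.continuous_ofReal.tendsto _).comp h2).mul_const Complex.I)
  rw [h3]
  refine (h4.congr fun N => ?_).trans (le_of_eq ?_)
  · simp only [Function.comp, meanUpTo, Nat.floor_natCast, ← Finset.sum_filter]
    push_cast
    rw [div_mul_eq_mul_div, ← add_div, Finset.sum_mul, ← Finset.sum_add_distrib, one_div,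
      inv_mul_eq_div]
    congr 1
    exact Finset.sum_congr rfl fun n _ => Complex.re_add_im _
  · congr 1
    push_cast; ring
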